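/- Write $S_n$ ($n\ge 0$) for the permutations of $\{1,\dots,n\}$, with $\pi\in S_n$ in tabular form $[\pi_1,\dots,\pi_n]$, and $e_n$ for the identity of $S_n$. A permutation is *evil-avoiding* if it avoids the patterns $2413, 4132, 4213, 3214$. A *recoil* of $\pi\in S_n$ is a value $i\in\{1,\dots,n-1\}$ that occurs after $i+1$ in $\pi$. Let $\mathrm{Evil}$ be the set of evil-avoiding permutations of all sizes $n\ge 0$, and $\mathrm{Evil}(n,k)$ the set of those in $S_n$ with $k$ recoils. Let $\rho_{i,j}$ insert the value $i$ at index $j$, increasing by $1$ all old values that are $\ge i$, and let $\gamma_{c,d}$ remove the entry at index $c$ and reinsert it at index $d$. Define partial operators $\psi_p,\psi_q,\psi_r,\psi_s$, taking $\pi\in S_n$ to a permutation in $S_{n+1}$: * $\psi_p(\pi)=\rho_{1,1}(\pi)$, for $\pi\in\mathrm{Evil}$ with at least one recoil; * $\psi_q$, for $\pi\in\mathrm{Evil}$ with at least one recoil: let $t$ be the least recoil. If, for some $a\ge 0$, $b\ge 1$ (then unique), $\pi$ begins with $1,2,\dots,a$ and ends with $a+1,\dots,a+b$, then $\psi_q(\pi)=\gamma_{n-b+2,\,a+2}(\rho_{t+1,1}(\pi))$;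 otherwise $\psi_q(\pi)=\rho_{t+1,1}(\pi)$; * $\psi_r(\pi)=\rho_{1,n+1}(\pi)$, for $\pi\in\mathrm{Evil}$ of size $n\ge 1$; * $\psi_s(\pi)=\rho_{\pi_n+1,\,n+1}(\pi)$, for $\pi\in\mathrm{Evil}$ ending with $1,2,\dots,t$ for some $t\ge 1$; also $\psi_s(e_0)=e_1$. A word $x_1x_2\cdots x_m$ over $\{p,q,r,s\}$ is *valid* if $\psi_{x_1}(\psi_{x_2}(\cdots\psi_{x_m}(e_0)))$ is defined, i.e. every operator is applied to an element of its domain; the word then *encodes* this permutation. Let $L_{\mathrm{Evil}}$ be the set of valid words of positive length. For $m\ge 1$ and $\pi\in S_j$ let $\beta_m(\pi)=[\pi_1+m,\dots,\pi_j+m,1,2,\dots,m]$. Then: 1. The four operators map their domains into $\mathrm{Evil}$. Every evil-avoiding permutation is encoded by exactly one valid word ($e_0$ by the empty word), and encoding is a bijection from $L_{\mathrm{Evil}}$ onto the evil-avoiding permutations of positive size. A valid word of length $n$ with exactly $k$ letters $r$ encodes an element of $\mathrm{Evil}(n,k)$. 2. $L_{\mathrm{Evil}}$ consists exactly of the words that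 end in $s$, contain neither $sp$ nor $sq$ as consecutive letters, and have neither $p$ nor $q$ immediately before the terminal string of $s$'s; equivalently, $L_{\mathrm{Evil}}$ is the language of the regular expression $((p|q)^*s^*r)^*s^+$. 3. On their domains, $\psi_p,\psi_q,\psi_s$ preserve the number of recoils and $\psi_r$ increases it by exactly one. 4. $\mathrm{Evil}(n,0)=\{e_n\}$ for all $n\ge 0$, and $\mathrm{Evil}(0,k)=\emptyset$ for $k\ge 1$. For all $n\ge 1$ and $k\ge 1$, $$\mathrm{Evil}(n,k)=\psi_p(\mathrm{Evil}(n-1,k))\ \sqcup\ \psi_q(\mathrm{Evil}(n-1,k))\ \sqcup\ \bigsqcup_{j=k}^{n-1}\beta_{n-j}(\mathrm{Evil}(j,k-1)),$$ and the sets on the right-hand side are pairwise disjoint. Moreover, for all $\pi\in\mathrm{Evil}$ of positive size and all $m\ge 0$, $\psi_s^m(\psi_r(\pi))$ lies in the domain of $\psi_s$ and equals $\beta_{m+1}(\pi)$. -/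

import Mathlib

open Equiv

namespace EvilPerm

/-- A permutation of arbitrary size: an element of the disjoint union of the symmetric groups
`S_n`, `n ≥ 0`. Positions and values of an element of `S_n` are elements of `Fin n`, so they are
`0, …, n - 1` instead of `1, …, n`. -/
abbrev SizedPerm : Type := Σ n : ℕ, Perm (Fin n)

/-- The identity `e_n` of `S_n`. -/
def idPerm (n : ℕ) : SizedPerm := ⟨n, 1⟩

/-- `π` contains the pattern `σ`, given in tabular form, if some subsequence of the values of `π`
has the same relative order as `σ`. -/
def Contains {n k : ℕ} (π : Perm (Fin n)) (σ : Fin k → ℕ) : Prop :=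
  ∃ f : Fin k ↪o Fin n, ∀ i j, π (f i) < π (f j) ↔ σ i < σ j

/-- The set of evil-avoiding permutations of all sizes. -/
def Evil : Set SizedPerm :=
  {π | ¬ Contains π.2 ![2, 4, 1, 3] ∧ ¬ Contains π.2 ![4, 1, 3, 2] ∧
    ¬ Contains π.2 ![4, 2, 1, 3] ∧ ¬ Contains π.2 ![3, 2, 1, 4]}

/-- The recoils of `π`: the values `v` that occur after `v + 1`. -/
def recoils {n : ℕ} (π : Perm (Fin n)) : Finset (Fin n) :=
  Finset.univ.filter fun v => ∃ h : (v : ℕ) + 1 < n, π.symm ⟨v + 1, h⟩ < π.symm v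

/-- The number of recoils. -/
def numRecoils (π : SizedPerm) : ℕ := (recoils π.2).card

/-- `EvilGraded n k`: the evil-avoiding permutations in `S_n` with `k` recoils. -/
def EvilGraded (n k : ℕ) : Set SizedPerm :=
  {π | π ∈ Evil ∧ π.1 = n ∧ numRecoils π = k}

/-- The insertion operator: insert the value `i` at position `j`, incrementing by one all old
values that are at least `i`. (Position `j` goes to `i`, and position `j.succAbove k`
goes to `i.succAbove (π k)`.) -/
def insertion {n : ℕ} (i j : Fin (n + 1)) (π : Perm (Fin n)) : Perm (Fin (n + 1)) :=
  ((finSuccEquiv' j).trans (optionCongr π)).trans (finSuccEquiv' i).symm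

/-- The shifting operator: remove the value at position `a` and insert it again so that it
is at position `b`, the other values keeping their order. -/
def shifting {n : ℕ} (a b : Fin (n + 1)) (π : Perm (Fin (n + 1))) : Perm (Fin (n + 1)) :=
  ((finSuccEquiv' b).trans (finSuccEquiv' a).symm).trans π

/-- `π` is `(a, b)`-sandwiched: in tabular form (values `1, …, n`) it begins with
`1, 2, …, a` and ends with `a + 1, a + 2, …, a + b`, where `a ≥ 0` and `b ≥ 1`. -/
def IsSandwiched {n : ℕ} (π : Perm (Fin n)) (a b : ℕ) : Prop :=
  1 ≤ b ∧ a + b ≤ n ∧ (∀ i : Fin n, (i : ℕ) < a → (π i : ℕ) = i) ∧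
    ∀ c : ℕ, c < b → ∃ i : Fin n, (i : ℕ) = n - b + c ∧ (π i : ℕ) = a + c

/-- `π` has `e_t` as a suffix for some positive `t`: in tabular form it ends
with `1, 2, …, t`. -/
def HasIdSuffix {n : ℕ} (π : Perm (Fin n)) : Prop :=
  ∃ t : ℕ, 1 ≤ t ∧ t ≤ n ∧ ∀ c : ℕ, c < t → ∃ i : Fin n, (i : ℕ) = n - t + c ∧ (π i : ℕ) = c

/-- The four letters naming the operators. -/
inductive Letter : Type
  | p | q | r | s
  deriving DecidableEq

/-- The operator `ψ_p`: insert the least value at the beginning. -/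
def psiP {n : ℕ} (π : Perm (Fin n)) : Perm (Fin (n + 1)) := insertion 0 0 π

open Classical in
/-- The operator `ψ_q`: with `t` the least recoil, insert the value `t + 1` at the beginning;
if `π` is `(a, b)`-sandwiched, then moreover move the entry at index `n - b + 2` to index `a + 2`
(these are indices starting from `1`). If `π` has no recoil, it is not in the domain of `ψ_q`, and
the value given here plays no role. A permutation with a recoil is `(a, b)`-sandwiched for at most
one pair `(a, b)`. -/
noncomputable def psiQ {n : ℕ} (π : Perm (Fin n)) : Perm (Fin (n + 1)) :=
  if h : (recoils π).Nonempty then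
    if hs : ∃ ab : ℕ × ℕ, IsSandwiched π ab.1 ab.2 then
      shifting
        ⟨n - hs.choose.2 + 1, by
          have h1 := hs.choose_spec.1; have h2 := hs.choose_spec.2.1; omega⟩
        ⟨hs.choose.1 + 1, by
          have h1 := hs.choose_spec.1; have h2 := hs.choose_spec.2.1; omega⟩
        (insertion ((recoils π).min' h).succ 0 π)
    else insertion ((recoils π).min' h).succ 0 π
  else insertion 0 0 π

/-- The operator `ψ_r`: insert the least value at the end. -/
def psiR {n : ℕ} (π : Perm (Fin n)) : Perm (Fin (n + 1)) := insertion 0 (Fin.last n) π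

/-- The operator `ψ_s`: insert at the end the successor of the last value (and the only possible
value if `π` is empty). -/
def psiS : {n : ℕ} → Perm (Fin n) → Perm (Fin (n + 1))
  | 0, π => insertion 0 0 π
  | m + 1, π => insertion (π (Fin.last m)).succ (Fin.last (m + 1)) π

/-- The four operators; `psi x` is only meant on the domain `psiDomain x`. -/
noncomputable def psi : Letter → SizedPerm → SizedPerm
  | .p, π => ⟨π.1 + 1, psiP π.2⟩
  | .q, π => ⟨π.1 + 1, psiQ π.2⟩
  | .r, π => ⟨π.1 + 1, psiR π.2⟩
  | .s, π => ⟨π.1 + 1, psiS π.2⟩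

/-- The domains of the four operators. -/
def psiDomain : Letter → Set SizedPerm
  | .p => {π | π ∈ Evil ∧ (recoils π.2).Nonempty}
  | .q => {π | π ∈ Evil ∧ (recoils π.2).Nonempty}
  | .r => {π | π ∈ Evil ∧ 1 ≤ π.1}
  | .s => {π | π ∈ Evil ∧ (π = idPerm 0 ∨ HasIdSuffix π.2)}

/-- The result of applying the operators named by a word to the empty permutation; the last letter
is applied first: `x₁ x₂ ⋯ x_m` gives `ψ_{x₁} (ψ_{x₂} (⋯ (ψ_{x_m} e_0)))`. -/
noncomputable def eval : List Letter → SizedPerm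
  | [] => idPerm 0
  | x :: w => psi x (eval w)

/-- The composition named by a word is defined at the empty permutation: each operator is applied
to an element of its domain. -/
def IsValid : List Letter → Prop
  | [] => True
  | x :: w => IsValid w ∧ eval w ∈ psiDomain x

/-- The language of valid words of positive length. -/
def LEvil : Language Letter := {w : List Letter | w ≠ [] ∧ IsValid w}

/-- The regular expression `((p|q)^* s^* r)^* s^+`. -/
def evilRegex : RegularExpression Letter :=
  let P := RegularExpression.char Letter.p
  let Q := RegularExpression.char Letter.q
  let R := RegularExpression.char Letter.r
  let S := RegularExpression.char Letter.s
  ((P + Q).star * S.star * R).star * (S * S.star)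

/-- The map that sends `[π_1, …, π_j]` to `[π_1 + m, …, π_j + m, 1, 2, …, m]`. -/
def appendBlock (m : ℕ) (π : SizedPerm) : SizedPerm :=
  ⟨π.1 + m,
    (finSumFinEquiv (m := π.1) (n := m)).symm.trans
      ((sumCongr π.2 (Equiv.refl (Fin m))).trans
        ((sumComm (Fin π.1) (Fin m)).trans
          (finSumFinEquiv.trans (finCongr (Nat.add_comm m π.1)))))⟩

end EvilPerm

/-!
Every question about a permutation `π` of size `n` is translated into one about the function `pos π`
that sends a value to its position; it is extended by the identity to a bijection of `ℕ`, so that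
all comparisons are between natural numbers. Evil-avoidance says that no four values
`a < b < c < d < n` are placed as in `Bad` (`mem_evil_iff`), a recoil is a `v` with
`pos π (v + 1) < pos π v`, and identity suffixes and sandwiches are given by explicit positions.

The heart of the matter is that the letter `x` and the argument `σ` in `π = ψ_x(σ)` can be read off
an evil-avoiding `π` of positive size. If `π` ends with `1, …, t`, then `x` is `r` or `s`,
depending on whether the last entry is `1`. Otherwise `x = p` if `π` begins with `1`, and `x = q` if
not (`isOutput_psi`, `isOutput_unique`, `exists_psi`). For `p`, `r`, `s` one just deletes the
inserted entry: the minimum at the beginning, the minimum at the end, and the last entry of an increasing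
suffix below everything else are never part of a new forbidden pattern.

The case of `q` is the hard one. Here values are counted from `0`, and `T` is the first entry of
`π`. The patterns `4132`, `4213` and `3214` force `T - 1` to be the least recoil, since otherwise
`π` would end with an identity suffix (`isLeastDrop_of_pos_eq_zero`). If `T + 1` precedes `T - 1`,
then deleting `T` leaves a permutation with the same least recoil; otherwise `2413` forces `π` to
begin with `T, 0, …, T - 1` (`isTwisted_of_lt`). The shift in the definition of `ψ_q` turns the
shape `T, 0, …, a - 1, M, a, …, T - 1` (from a sandwiched argument with a new first entry) into
`T, 0, …, a, M, a + 1, …, T - 1` (called twisted), and the moved value `a` belongs to no forbidden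
pattern in either of them (`mem_evil_shift_iff`). So twisted permutations come from sandwiched ones,
and the others from those that are not sandwiched (`psiQ_cases`, `exists_psiQ`).

Unique factorization follows by induction on the size. The domain conditions become conditions on
letters: having a recoil means containing `r`, and having an identity suffix means beginning with
`r` or `s` (`isValid_cons_iff`). This gives both descriptions of the language, and, since
`ψ_s^m ψ_r` is a block operator, the decomposition by size and number of recoils: its parts collect
the words that begin with `p`, with `q`, and with `s^m r` for the various `m`.
-/

namespace EvilPerm

/-! ### Positions, patterns and recoils -/

/-- The position of the value `v` in `π`. Values `v ≥ n`, which `π` does not have, are given the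
position `v`, so that `pos π` is a bijection of `ℕ`. -/
def pos {n : ℕ} (π : Perm (Fin n)) (v : ℕ) : ℕ := if h : v < n then (π.symm ⟨v, h⟩ : ℕ) else v

lemma pos_of_lt {n : ℕ} (π : Perm (Fin n)) {v : ℕ} (h : v < n) :
    pos π v = (π.symm ⟨v, h⟩ : ℕ) := dif_pos h

lemma pos_of_le {n : ℕ} (π : Perm (Fin n)) {v : ℕ} (h : n ≤ v) : pos π v = v :=
  dif_neg (by omega)

lemma pos_lt {n : ℕ} (π : Perm (Fin n)) {v : ℕ} (h : v < n) : pos π v < n := by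
  rw [pos_of_lt π h]; exact Fin.is_lt _

lemma pos_val {n : ℕ} (π : Perm (Fin n)) (v : Fin n) : pos π v = (π.symm v : ℕ) :=
  pos_of_lt π v.2

lemma pos_apply {n : ℕ} (π : Perm (Fin n)) (i : Fin n) : pos π (π i) = i := by
  rw [pos_val, symm_apply_apply]

lemma pos_injective {n : ℕ} (π : Perm (Fin n)) : Function.Injective (pos π) := by
  intro u v h
  by_cases hu : u < n <;> by_cases hv : v < n
  · rw [pos_of_lt π hu, pos_of_lt π hv] at h
    simpa using π.symm.injective (Fin.ext h)
  · have := pos_lt π hu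
    rw [pos_of_le π (not_lt.1 hv)] at h; omega
  · have := pos_lt π hv
    rw [pos_of_le π (not_lt.1 hu)] at h; omega
  · rwa [pos_of_le π (not_lt.1 hu), pos_of_le π (not_lt.1 hv)] at h

lemma pos_ne {n : ℕ} (π : Perm (Fin n)) {u v : ℕ} (h : u ≠ v) : pos π u ≠ pos π v :=
  (pos_injective π).ne h

lemma exists_pos_eq {n : ℕ} (π : Perm (Fin n)) {k : ℕ} (h : k < n) : ∃ v < n, pos π v = k :=
  ⟨π ⟨k, h⟩, Fin.is_lt _, pos_apply π ⟨k, h⟩⟩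

lemma pos_eq_iff {n : ℕ} (π : Perm (Fin n)) (i v : Fin n) : pos π v = i ↔ π i = v := by
  rw [pos_val, Fin.val_inj, symm_apply_eq, eq_comm]

lemma perm_ext_of_pos {n : ℕ} {π σ : Perm (Fin n)} (h : ∀ v < n, pos π v = pos σ v) : π = σ := by
  rw [← Equiv.symm_symm π, ← Equiv.symm_symm σ]
  congr 1
  ext v
  rw [← pos_val, ← pos_val]
  exact h v v.2

lemma sizedPerm_ext_of_pos {π σ : SizedPerm} (hn : π.1 = σ.1)
    (h : ∀ v < π.1, pos π.2 v = pos σ.2 v) : π = σ := by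
  obtain ⟨n, π⟩ := π
  obtain ⟨m, σ⟩ := σ
  obtain rfl : n = m := hn
  rw [show π = σ from perm_ext_of_pos h]

/-- The position of a value is the number of values that precede it. -/
lemma pos_eq_card {n : ℕ} (π : Perm (Fin n)) {u : ℕ} (hu : u < n) :
    pos π u = ((Finset.range n).filter fun v => pos π v < pos π u).card := by
  have : ((Finset.range n).filter fun v => pos π v < pos π u).image (pos π) =
      Finset.range (pos π u) := by
    ext k
    simp only [Finset.mem_image, Finset.mem_filter, Finset.mem_range]
    constructor
    · rintro ⟨v, ⟨-, h⟩, rfl⟩; exact h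
    · intro h
      obtain ⟨v, hv, rfl⟩ := exists_pos_eq π (h.trans (pos_lt π hu))
      exact ⟨v, ⟨hv, h⟩, rfl⟩
  rw [← Finset.card_image_of_injective _ (pos_injective π), this, Finset.card_range]

lemma pos_one (n v : ℕ) : pos (1 : Perm (Fin n)) v = v := by
  unfold pos; split <;> rfl

/-- The values `a < b < c < d`, placed by `f`, form one of the four forbidden patterns; the
disjuncts stand for `2413`, `4132`, `4213` and `3214`, in this order. -/
def Bad (f : ℕ → ℕ) (a b c d : ℕ) : Prop :=
  (f b < f d ∧ f d < f a ∧ f a < f c) ∨ (f d < f a ∧ f a < f c ∧ f c < f b) ∨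
    (f d < f b ∧ f b < f a ∧ f a < f c) ∨ (f c < f b ∧ f b < f a ∧ f a < f d)

/-- No four values in `S` below `n`, placed by `f`, form a forbidden pattern. -/
def NoBad (n : ℕ) (S : Set ℕ) (f : ℕ → ℕ) : Prop :=
  ∀ a b c d, a < b → b < c → c < d → d < n → a ∈ S → b ∈ S → c ∈ S → d ∈ S → ¬ Bad f a b c d

/-- A pattern of length four occurs if values of the right relative order occur in the right order
of positions. Here `ρ` maps the indices of the pattern to the ranks of its entries. -/
lemma contains_iff {n : ℕ} (π : Perm (Fin n)) (σ : Fin 4 → ℕ) (ρ : Perm (Fin 4))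
    (h : ∀ x y, σ x < σ y ↔ ρ x < ρ y) :
    Contains π σ ↔ ∃ a b c d, a < b ∧ b < c ∧ c < d ∧ d < n ∧
      pos π (![a, b, c, d] (ρ 0)) < pos π (![a, b, c, d] (ρ 1)) ∧
      pos π (![a, b, c, d] (ρ 1)) < pos π (![a, b, c, d] (ρ 2)) ∧
      pos π (![a, b, c, d] (ρ 2)) < pos π (![a, b, c, d] (ρ 3)) := by
  constructor
  · rintro ⟨f, hf⟩
    let v : Fin 4 → ℕ := fun y => π (f (ρ.symm y))
    have hv : StrictMono v := fun x y hxy => by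
      have := hf (ρ.symm x) (ρ.symm y)
      simp only [h, apply_symm_apply] at this
      exact this.2 hxy
    have hv' : ![v 0, v 1, v 2, v 3] = v := by
      ext x; fin_cases x <;> rfl
    have hp : ∀ x, pos π (v (ρ x)) = f x := fun x => by
      simp only [v, symm_apply_apply, pos_apply]
    refine ⟨v 0, v 1, v 2, v 3, hv (by decide), hv (by decide), hv (by decide), Fin.is_lt _, ?_⟩
    simp only [hv', hp]
    exact ⟨f.strictMono (by decide), f.strictMono (by decide), f.strictMono (by decide)⟩
  · rintro ⟨a, b, c, d, h1, h2, h3, h4, h5, h6, h7⟩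
    let v : Fin 4 → Fin n := ![⟨a, by omega⟩, ⟨b, by omega⟩, ⟨c, by omega⟩, ⟨d, h4⟩]
    have hv : StrictMono v := by
      rw [Fin.strictMono_iff_lt_succ]
      intro x
      fin_cases x
      exacts [h1, h2, h3]
    have hv' : ∀ x, ![a, b, c, d] x = v x := by
      intro x; fin_cases x <;> rfl
    have hs : StrictMono fun x => π.symm (v (ρ x)) := by
      rw [Fin.strictMono_iff_lt_succ]
      simp only [hv', pos_val] at h5 h6 h7
      intro x
      fin_cases x
      exacts [h5, h6, h7]
    refine ⟨OrderEmbedding.ofStrictMono _ hs, fun x y => ?_⟩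
    simp [hv.lt_iff_lt, h]

lemma mem_evil_iff {π : SizedPerm} : π ∈ Evil ↔ NoBad π.1 Set.univ (pos π.2) := by
  have h1 := contains_iff π.2 ![2, 4, 1, 3] ⟨![1, 3, 0, 2], ![2, 0, 3, 1], by decide, by decide⟩
    (by decide)
  have h2 := contains_iff π.2 ![4, 1, 3, 2] ⟨![3, 0, 2, 1], ![1, 3, 2, 0], by decide, by decide⟩
    (by decide)
  have h3 := contains_iff π.2 ![4, 2, 1, 3] ⟨![3, 1, 0, 2], ![2, 1, 3, 0], by decide, by decide⟩
    (by decide)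
  have h4 := contains_iff π.2 ![3, 2, 1, 4] ⟨![2, 1, 0, 3], ![2, 1, 0, 3], by decide, by decide⟩
    (by decide)
  simp only [coe_fn_mk, Matrix.cons_val] at h1 h2 h3 h4
  simp only [Evil, Set.mem_ofPred_eq, h1, h2, h3, h4, NoBad, Bad, Set.mem_univ, true_imp_iff]
  constructor
  · rintro ⟨k1, k2, k3, k4⟩ a b c d hab hbc hcd hd (k | k | k | k)
    exacts [k1 ⟨a, b, c, d, hab, hbc, hcd, hd, k⟩, k2 ⟨a, b, c, d, hab, hbc, hcd, hd, k⟩,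
      k3 ⟨a, b, c, d, hab, hbc, hcd, hd, k⟩, k4 ⟨a, b, c, d, hab, hbc, hcd, hd, k⟩]
  · intro k
    exact ⟨fun ⟨a, b, c, d, h1, h2, h3, h4, h⟩ =>
        k a b c d h1 h2 h3 h4 (Or.inl h),
      fun ⟨a, b, c, d, h1, h2, h3, h4, h⟩ =>
        k a b c d h1 h2 h3 h4 (Or.inr (Or.inl h)),
      fun ⟨a, b, c, d, h1, h2, h3, h4, h⟩ =>
        k a b c d h1 h2 h3 h4 (Or.inr (Or.inr (Or.inl h))),
      fun ⟨a, b, c, d, h1, h2, h3, h4, h⟩ =>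
        k a b c d h1 h2 h3 h4 (Or.inr (Or.inr (Or.inr h)))⟩

lemma mem_recoils_iff {n : ℕ} {π : Perm (Fin n)} {v : Fin n} :
    v ∈ recoils π ↔ pos π (v + 1) < pos π v := by
  simp only [recoils, Finset.mem_filter, Finset.mem_univ, true_and]
  by_cases h : (v : ℕ) + 1 < n
  · rw [pos_of_lt π h, pos_val]
    exact ⟨fun ⟨_, h'⟩ => h', fun h' => ⟨h, h'⟩⟩
  · have := pos_lt π v.2
    rw [pos_of_le π (not_lt.1 h)]
    constructor
    · rintro ⟨h', -⟩; omega
    · intro; omega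

lemma recoils_nonempty_iff {n : ℕ} {π : Perm (Fin n)} :
    (recoils π).Nonempty ↔ ∃ v, pos π (v + 1) < pos π v := by
  constructor
  · rintro ⟨v, hv⟩; exact ⟨v, mem_recoils_iff.1 hv⟩
  · rintro ⟨v, hv⟩
    have : v < n := by
      by_contra h
      rw [pos_of_le π (by omega), pos_of_le π (by omega)] at hv
      omega
    exact ⟨⟨v, this⟩, mem_recoils_iff.2 hv⟩

lemma numRecoils_eq (π : SizedPerm) :
    numRecoils π = ((Finset.range π.1).filter fun v => pos π.2 (v + 1) < pos π.2 v).card := by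
  unfold numRecoils
  rw [← Finset.card_map Fin.valEmbedding]
  congr 1
  ext v
  simp only [Finset.mem_map, mem_recoils_iff, Fin.valEmbedding_apply, Finset.mem_filter,
    Finset.mem_range]
  constructor
  · rintro ⟨v, hv, rfl⟩; exact ⟨v.2, hv⟩
  · rintro ⟨hv, h⟩; exact ⟨⟨v, hv⟩, h, rfl⟩

lemma lt_of_forall_succ {f : ℕ → ℕ} {m : ℕ} (h : ∀ v, v + 1 < m → f v < f (v + 1)) {u v : ℕ}
    (huv : u < v) (hv : v < m) : f u < f v := by
  induction v, huv using Nat.le_induction with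
  | base => exact h u hv
  | succ v _ ih => exact (ih (by omega)).trans (h v hv)

/-- The identity is the only permutation without recoils. -/
lemma pos_eq_self_of_recoils {n : ℕ} {π : Perm (Fin n)} (h : ¬ (recoils π).Nonempty) (v : ℕ) :
    pos π v = v := by
  have hm : StrictMono (pos π) := strictMono_nat_of_lt_succ fun v => by
    by_contra hv
    exact h (recoils_nonempty_iff.2
      ⟨v, lt_of_le_of_ne (not_lt.1 hv) (pos_ne π (Nat.succ_ne_self v))⟩)
  rcases lt_or_ge v n with hv | hv
  · rw [pos_eq_card π hv]
    simp only [hm.lt_iff_lt]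
    have : (Finset.range n).filter (· < v) = Finset.range v := by
      ext u; simp only [Finset.mem_filter, Finset.mem_range]; omega
    rw [this, Finset.card_range]
  · exact pos_of_le π hv

/-! ### Insertion, shift and deletion -/

lemma pos_insertion_self {n : ℕ} (i j : Fin (n + 1)) (π : Perm (Fin n)) :
    pos (insertion i j π) i = j := by
  rw [pos_eq_iff]; simp [insertion]

lemma pos_insertion_succAbove {n : ℕ} (i j : Fin (n + 1)) (π : Perm (Fin n)) (k : Fin n) :
    pos (insertion i j π) (i.succAbove k) = j.succAbove (π.symm k) := by
  rw [pos_eq_iff]; simp [insertion]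

lemma pos_insertion_zero {n : ℕ} (i : Fin (n + 1)) (π : Perm (Fin n)) (v : ℕ) :
    pos (insertion i 0 π) v =
      if v = i then 0 else if v < i then pos π v + 1 else pos π (v - 1) + 1 := by
  split_ifs with h1 h2
  · subst h1; rw [pos_insertion_self]; rfl
  · have hv : v < n := by omega
    have := pos_insertion_succAbove i 0 π ⟨v, hv⟩
    rw [Fin.succAbove_of_castSucc_lt _ _ (by simpa [Fin.lt_def] using h2)] at this
    simpa [pos_of_lt π hv] using this
  · by_cases hv : v < n + 1
    · have := pos_insertion_succAbove i 0 π ⟨v - 1, by omega⟩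
      rw [Fin.succAbove_of_le_castSucc _ _ (by simp only [Fin.le_def, Fin.val_castSucc]; omega)]
        at this
      simp only [Fin.val_succ, Fin.succAbove_zero] at this
      rwa [Nat.sub_add_cancel (by omega), ← pos_val] at this
    · rw [pos_of_le _ (by omega), pos_of_le _ (by omega)]; omega

lemma pos_insertion_last {n : ℕ} (i : Fin (n + 1)) (π : Perm (Fin n)) {v : ℕ} (hv : v ≤ n) :
    pos (insertion i (Fin.last n) π) v =
      if v = i then n else if v < i then pos π v else pos π (v - 1) := by
  split_ifs with h1 h2
  · subst h1; rw [pos_insertion_self]; rfl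
  · have hv : v < n := by omega
    have := pos_insertion_succAbove i (Fin.last n) π ⟨v, hv⟩
    rw [Fin.succAbove_of_castSucc_lt _ _ (by simpa [Fin.lt_def] using h2)] at this
    simpa [pos_of_lt π hv] using this
  · have := pos_insertion_succAbove i (Fin.last n) π ⟨v - 1, by omega⟩
    rw [Fin.succAbove_of_le_castSucc _ _ (by simp only [Fin.le_def, Fin.val_castSucc]; omega)]
      at this
    simp only [Fin.val_succ, Fin.succAbove_last, Fin.val_castSucc] at this
    rwa [Nat.sub_add_cancel (by omega), ← pos_val] at this

lemma pos_shifting {n : ℕ} {a b : Fin (n + 1)} (hab : b ≤ a) (π : Perm (Fin (n + 1))) (v : ℕ) :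
    pos (shifting a b π) v = if pos π v = a then (b : ℕ) else
      if (b : ℕ) ≤ pos π v ∧ pos π v < a then pos π v + 1 else pos π v := by
  by_cases hv : v < n + 1
  · have key : pos (shifting a b π) v =
        ((finSuccEquiv' b).symm (finSuccEquiv' a (π.symm ⟨v, hv⟩)) : ℕ) := by
      rw [pos_of_lt _ hv]; rfl
    rw [key, pos_of_lt π hv]
    generalize π.symm ⟨v, hv⟩ = k
    rw [Fin.le_def] at hab
    rcases Fin.eq_self_or_eq_succAbove a k with rfl | ⟨k, rfl⟩
    · simp
    · simp only [finSuccEquiv'_succAbove, finSuccEquiv'_symm_some]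
      simp only [Fin.succAbove, Fin.lt_def, Fin.val_castSucc]
      split_ifs <;> simp only [Fin.val_castSucc, Fin.val_succ] at * <;> omega
  · rw [pos_of_le _ (by omega), pos_of_le _ (by omega)]
    have := a.2
    split_ifs <;> omega

lemma shifting_shifting {n : ℕ} (a b : Fin (n + 1)) (π : Perm (Fin (n + 1))) :
    shifting a b (shifting b a π) = π := by
  ext i; simp [shifting]

lemma exists_insertion {n : ℕ} (π : Perm (Fin (n + 1))) {i j : Fin (n + 1)} (h : π j = i) :
    ∃ σ, insertion i j σ = π := by
  let e : Perm (Option (Fin n)) := (finSuccEquiv' j).symm.trans (π.trans (finSuccEquiv' i))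
  have he : optionCongr (removeNone e) = e := by
    have : e none = none := by simp [e, h]
    rw [map_equiv_removeNone, this, swap_self]; rfl
  refine ⟨removeNone e, ?_⟩
  unfold insertion
  rw [he]
  ext k; simp [e]

lemma insertion_zero_injective {n : ℕ} (i : Fin (n + 1)) :
    Function.Injective fun π : Perm (Fin n) => insertion i 0 π := by
  intro π σ h
  refine perm_ext_of_pos fun v hv => ?_
  have h1 := congrArg (fun τ => pos τ v) h
  have h2 := congrArg (fun τ => pos τ (v + 1)) h
  simp only [pos_insertion_zero, Nat.add_sub_cancel] at h1 h2
  split_ifs at h1 h2 <;> omega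

lemma insertion_last_injective {n : ℕ} (i : Fin (n + 1)) :
    Function.Injective fun π : Perm (Fin n) => insertion i (Fin.last n) π := by
  intro π σ h
  refine perm_ext_of_pos fun v hv => ?_
  have h1 := congrArg (fun τ => pos τ v) h
  have h2 := congrArg (fun τ => pos τ (v + 1)) h
  simp only [pos_insertion_last _ _ hv.le, pos_insertion_last _ _ (show v + 1 ≤ n from hv),
    Nat.add_sub_cancel] at h1 h2
  split_ifs at h1 h2 <;> omega

/-- Deleting the value `i` turns the forbidden patterns that avoid `i` into the forbidden patterns
of the smaller permutation. -/
lemma noBad_iff_of_delete {n i : ℕ} {f g : ℕ → ℕ} (hi : i ≤ n)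
    (h : ∀ u v, u < n → v < n →
      (f u < f v ↔ g (if u < i then u else u + 1) < g (if v < i then v else v + 1))) :
    NoBad n Set.univ f ↔ NoBad (n + 1) {i}ᶜ g := by
  constructor
  · intro hf a b c d hab hbc hcd hd ha hb hc hd' hB
    simp only [Set.mem_compl_iff, Set.mem_singleton_iff] at ha hb hc hd'
    let s : ℕ → ℕ := fun u => if u < i then u else u - 1
    have hs : ∀ u, u ≠ i → (if s u < i then s u else s u + 1) = u := by
      intro u hu; simp only [s]; split_ifs <;> omega
    refine hf (s a) (s b) (s c) (s d) ?_ ?_ ?_ ?_ trivial trivial trivial trivial ?_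
    · simp only [s]; split_ifs <;> omega
    · simp only [s]; split_ifs <;> omega
    · simp only [s]; split_ifs <;> omega
    · simp only [s]; split_ifs <;> omega
    · have hsn : ∀ u, u ≤ d → u ≠ i → s u < n := by
        intro u hu hi; simp only [s]; split_ifs <;> omega
      have hh : ∀ u v, u ≤ d → v ≤ d → u ≠ i → v ≠ i → (f (s u) < f (s v) ↔ g u < g v) := by
        intro u v hu hv hui hvi
        rw [h _ _ (hsn u hu hui) (hsn v hv hvi), hs u hui, hs v hvi]
      unfold Bad at hB ⊢
      rwa [hh b d, hh d a, hh a c, hh c b, hh d b, hh b a, hh a d] <;> omega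
  · intro hg a b c d hab hbc hcd hd _ _ _ _ hB
    refine hg (if a < i then a else a + 1) (if b < i then b else b + 1)
      (if c < i then c else c + 1) (if d < i then d else d + 1) ?_ ?_ ?_ ?_ ?_ ?_ ?_ ?_ ?_
    · split_ifs <;> omega
    · split_ifs <;> omega
    · split_ifs <;> omega
    · split_ifs <;> omega
    · simp only [Set.mem_compl_iff, Set.mem_singleton_iff]; split_ifs <;> omega
    · simp only [Set.mem_compl_iff, Set.mem_singleton_iff]; split_ifs <;> omega
    · simp only [Set.mem_compl_iff, Set.mem_singleton_iff]; split_ifs <;> omega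
    · simp only [Set.mem_compl_iff, Set.mem_singleton_iff]; split_ifs <;> omega
    · unfold Bad at hB ⊢
      simp only [← h b d (by omega) (by omega), ← h d a (by omega) (by omega),
        ← h a c (by omega) (by omega), ← h c b (by omega) (by omega), ← h d b (by omega) (by omega),
        ← h b a (by omega) (by omega), ← h a d (by omega) (by omega)]
      exact hB

lemma noBad_insertion_zero {n : ℕ} (i : Fin (n + 1)) (π : Perm (Fin n)) :
    NoBad n Set.univ (pos π) ↔ NoBad (n + 1) {(i : ℕ)}ᶜ (pos (insertion i 0 π)) := by
  refine noBad_iff_of_delete (Nat.lt_succ_iff.1 i.2) fun u v _ _ => ?_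
  simp only [pos_insertion_zero]
  split_ifs <;> (try simp only [Nat.add_sub_cancel]) <;> omega

lemma noBad_insertion_last {n : ℕ} (i : Fin (n + 1)) (π : Perm (Fin n)) :
    NoBad n Set.univ (pos π) ↔ NoBad (n + 1) {(i : ℕ)}ᶜ (pos (insertion i (Fin.last n) π)) := by
  refine noBad_iff_of_delete (Nat.lt_succ_iff.1 i.2) fun u v hu hv => ?_
  rw [pos_insertion_last _ _ (by split_ifs <;> omega),
    pos_insertion_last _ _ (by split_ifs <;> omega)]
  split_ifs <;> (try simp only [Nat.add_sub_cancel]) <;> omega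

lemma NoBad.mono {n : ℕ} {S T : Set ℕ} {f : ℕ → ℕ} (h : NoBad n T f) (hST : S ⊆ T) :
    NoBad n S f :=
  fun a b c d hab hbc hcd hd ha hb hc hd' =>
    h a b c d hab hbc hcd hd (hST ha) (hST hb) (hST hc) (hST hd')

/-- To see that there is no forbidden pattern, treat separately those that use a given value `i` and
those that do not. -/
lemma noBad_of_compl {n i : ℕ} {S : Set ℕ} {f : ℕ → ℕ} (h : NoBad n (S \ {i}) f)
    (h' : ∀ a b c d, a < b → b < c → c < d → d < n → a ∈ S → b ∈ S → c ∈ S → d ∈ S →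
      (a = i ∨ b = i ∨ c = i ∨ d = i) → ¬ Bad f a b c d) : NoBad n S f := by
  intro a b c d hab hbc hcd hd ha hb hc hd'
  by_cases hi : a = i ∨ b = i ∨ c = i ∨ d = i
  · exact h' a b c d hab hbc hcd hd ha hb hc hd' hi
  · simp only [not_or] at hi
    exact h a b c d hab hbc hcd hd ⟨ha, hi.1⟩ ⟨hb, hi.2.1⟩ ⟨hc, hi.2.2.1⟩ ⟨hd', hi.2.2.2⟩

/-! ### Permutations with an identity suffix and sandwiched permutations -/

lemma hasIdSuffix_iff {n : ℕ} {π : Perm (Fin n)} :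
    HasIdSuffix π ↔ ∃ t, 1 ≤ t ∧ t ≤ n ∧ ∀ c < t, pos π c = n - t + c := by
  refine exists_congr fun t => and_congr_right fun ht => and_congr_right fun htn =>
    forall_congr' fun c => forall_congr' fun hc => ?_
  constructor
  · rintro ⟨i, hi, hc⟩
    rw [← hi, ← hc, pos_apply]
  · intro h
    refine ⟨⟨n - t + c, by omega⟩, rfl, ?_⟩
    rw [(pos_eq_iff π ⟨n - t + c, by omega⟩ ⟨c, by omega⟩).1 h]

lemma isSandwiched_iff {n a b : ℕ} {π : Perm (Fin n)} :
    IsSandwiched π a b ↔ 1 ≤ b ∧ a + b ≤ n ∧ (∀ i < a, pos π i = i) ∧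
      ∀ c < b, pos π (a + c) = n - b + c := by
  refine and_congr_right fun hb => and_congr_right fun hab => and_congr ?_ ?_
  · constructor
    · intro h i hi
      have := h ⟨i, by omega⟩ hi
      have h' := pos_apply π ⟨i, by omega⟩
      rwa [this] at h'
    · intro h i hi
      have := (pos_eq_iff π i i).1 (h i hi)
      rw [this]
  · refine forall_congr' fun c => forall_congr' fun hc => ?_
    constructor
    · rintro ⟨i, hi, hc⟩
      rw [← hi, ← hc, pos_apply]
    · intro h
      refine ⟨⟨n - b + c, by omega⟩, rfl, ?_⟩
      rw [(pos_eq_iff π ⟨n - b + c, by omega⟩ ⟨a + c, by omega⟩).1 h]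

/-- An identity suffix can be recognized from the relative order of the values alone. -/
lemma hasIdSuffix_of_order {n t : ℕ} {π : Perm (Fin n)} (ht : 1 ≤ t) (htn : t ≤ n)
    (h1 : ∀ u v, u < t → t ≤ v → v < n → pos π v < pos π u)
    (h2 : ∀ u v, u < v → v < t → pos π u < pos π v) : HasIdSuffix π := by
  refine hasIdSuffix_iff.2 ⟨t, ht, htn, fun c hc => ?_⟩
  rw [pos_eq_card π (by omega)]
  have : (Finset.range n).filter (fun v => pos π v < pos π c) =
      Finset.Ico t n ∪ Finset.range c := by
    ext v
    simp only [Finset.mem_filter, Finset.mem_range, Finset.mem_union, Finset.mem_Ico]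
    constructor
    · rintro ⟨hv, hvc⟩
      by_contra h
      rcases eq_or_ne v c with rfl | hne
      · omega
      · have := h2 c v (by omega) (by omega)
        omega
    · rintro (⟨h, h'⟩ | h)
      · exact ⟨h', h1 c v hc h h'⟩
      · exact ⟨by omega, h2 v c h hc⟩
  rw [this, Finset.card_union_of_disjoint, Nat.card_Ico, Finset.card_range]
  rw [Finset.disjoint_left]
  intro v
  simp only [Finset.mem_range, Finset.mem_Ico]
  omega

lemma recoil_lt {n : ℕ} {π : Perm (Fin n)} {v : ℕ} (h : pos π (v + 1) < pos π v) : v + 1 < n := by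
  by_contra h'
  rw [pos_of_le π (v := v + 1) (by omega)] at h
  rcases lt_or_ge v n with hv | hv
  · have := pos_lt π hv
    omega
  · rw [pos_of_le π hv] at h; omega

/-- The recoils as a set of natural numbers. No bound on `v` is needed, since `pos π` is the
identity on values `v ≥ n`. -/
def recoilSet {n : ℕ} (π : Perm (Fin n)) : Set ℕ := {v | pos π (v + 1) < pos π v}

lemma mem_recoilSet {n : ℕ} {π : Perm (Fin n)} {v : ℕ} :
    v ∈ recoilSet π ↔ pos π (v + 1) < pos π v := Iff.rfl

lemma recoilSet_finite {n : ℕ} (π : Perm (Fin n)) : (recoilSet π).Finite :=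
  (Set.finite_lt_nat n).subset fun _ hv => (Nat.lt_succ_self _).trans (recoil_lt hv)

lemma numRecoils_eq_ncard (π : SizedPerm) : numRecoils π = (recoilSet π.2).ncard := by
  rw [numRecoils_eq, ← Set.ncard_coe_finset]
  congr 1
  ext v
  simp only [Finset.coe_filter, Finset.mem_range, Set.mem_ofPred_eq, mem_recoilSet,
    and_iff_right_iff_imp]
  intro h
  have := recoil_lt h
  omega

lemma recoils_nonempty_iff_numRecoils {π : SizedPerm} :
    (recoils π.2).Nonempty ↔ numRecoils π ≠ 0 := by
  rw [numRecoils, Finset.card_ne_zero]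

lemma eq_idPerm_of_recoils {π : SizedPerm} (h : ¬ (recoils π.2).Nonempty) : π = idPerm π.1 :=
  sizedPerm_ext_of_pos rfl fun v _ => by
    rw [pos_eq_self_of_recoils h]; exact (pos_one _ _).symm

lemma numRecoils_idPerm (n : ℕ) : numRecoils (idPerm n) = 0 := by
  by_contra h
  obtain ⟨v, hv⟩ := recoils_nonempty_iff.1 (recoils_nonempty_iff_numRecoils.2 h)
  rw [idPerm, pos_one, pos_one] at hv
  omega

lemma idPerm_mem_evil (n : ℕ) : idPerm n ∈ Evil := by
  rw [mem_evil_iff]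
  intro a b c d hab hbc hcd _ _ _ _ _ h
  simp only [idPerm, Bad, pos_one] at h
  omega

lemma hasIdSuffix_idPerm {n : ℕ} (hn : 1 ≤ n) : HasIdSuffix (idPerm n).2 :=
  hasIdSuffix_iff.2 ⟨n, hn, le_rfl, fun c _ => by simp [idPerm, pos_one]⟩

lemma mem_evil_iff_insertion_zero {n : ℕ} {i : Fin (n + 1)} {π : Perm (Fin n)} :
    (⟨n, π⟩ : SizedPerm) ∈ Evil ↔ NoBad (n + 1) {(i : ℕ)}ᶜ (pos (insertion i 0 π)) := by
  rw [mem_evil_iff, ← noBad_insertion_zero]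

lemma mem_evil_iff_insertion_last {n : ℕ} {i : Fin (n + 1)} {π : Perm (Fin n)} :
    (⟨n, π⟩ : SizedPerm) ∈ Evil ↔
      NoBad (n + 1) {(i : ℕ)}ᶜ (pos (insertion i (Fin.last n) π)) := by
  rw [mem_evil_iff, ← noBad_insertion_last]

lemma mem_evil_of_compl {n i : ℕ} {π : Perm (Fin n)} (h : NoBad n {i}ᶜ (pos π))
    (h' : ∀ a b c d, a < b → b < c → c < d → d < n →
      (a = i ∨ b = i ∨ c = i ∨ d = i) → ¬ Bad (pos π) a b c d) :
    (⟨n, π⟩ : SizedPerm) ∈ Evil := by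
  rw [mem_evil_iff]
  refine noBad_of_compl (i := i) (h.mono fun x hx => hx.2) ?_
  intro a b c d h1 h2 h3 h4 _ _ _ _ h5
  exact h' a b c d h1 h2 h3 h4 h5

/-! ### The operator `ψ_p` -/

lemma pos_psiP {n : ℕ} (π : Perm (Fin n)) (v : ℕ) :
    pos (psiP π) v = if v = 0 then 0 else pos π (v - 1) + 1 := by
  rw [psiP, pos_insertion_zero]; simp

lemma psiP_mem_evil_iff {n : ℕ} {π : Perm (Fin n)} :
    (⟨n + 1, psiP π⟩ : SizedPerm) ∈ Evil ↔ (⟨n, π⟩ : SizedPerm) ∈ Evil := by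
  rw [mem_evil_iff_insertion_zero (π := π) (i := 0)]
  refine ⟨fun h => (mem_evil_iff.1 h).mono (Set.subset_univ _), fun h => mem_evil_of_compl h ?_⟩
  -- no forbidden pattern begins with its least entry
  have h0 := pos_psiP π 0
  simp only [if_pos] at h0
  intro a b c d hab hbc hcd hd hi hB
  obtain rfl : a = 0 := by simp only [Fin.val_zero] at hi; omega
  unfold Bad at hB
  omega

lemma recoilSet_psiP {n : ℕ} (π : Perm (Fin n)) :
    recoilSet (psiP π) = Nat.succ '' recoilSet π := by
  ext v
  simp only [mem_recoilSet, Set.mem_image, pos_psiP]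
  cases v with
  | zero => simp
  | succ v => simp

lemma exists_psiP {n : ℕ} {π : Perm (Fin (n + 1))} (h : pos π 0 = 0) : ∃ σ, psiP σ = π :=
  exists_insertion π ((pos_eq_iff π 0 0).1 h)

/-! ### The operator `ψ_r` -/

lemma pos_psiR {n : ℕ} (π : Perm (Fin n)) {v : ℕ} (hv : v ≤ n) :
    pos (psiR π) v = if v = 0 then n else pos π (v - 1) := by
  rw [psiR, pos_insertion_last _ _ hv]; simp

lemma psiR_mem_evil_iff {n : ℕ} {π : Perm (Fin n)} :
    (⟨n + 1, psiR π⟩ : SizedPerm) ∈ Evil ↔ (⟨n, π⟩ : SizedPerm) ∈ Evil := by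
  rw [mem_evil_iff_insertion_last (π := π) (i := 0)]
  refine ⟨fun h => (mem_evil_iff.1 h).mono (Set.subset_univ _), fun h => mem_evil_of_compl h ?_⟩
  -- no forbidden pattern ends with its least entry
  intro a b c d hab hbc hcd hd hi hB
  obtain rfl : a = 0 := by simp only [Fin.val_zero] at hi; omega
  have h0 := pos_psiR π (v := 0) (by omega)
  simp only [if_pos] at h0
  have hb := pos_lt (psiR π) (v := b) (by omega)
  have hc := pos_lt (psiR π) (v := c) (by omega)
  have hd := pos_lt (psiR π) (v := d) (by omega)
  unfold Bad at hB
  simp only [psiR] at *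
  omega

lemma recoilSet_psiR {n : ℕ} (hn : 1 ≤ n) (π : Perm (Fin n)) :
    recoilSet (psiR π) = insert 0 (Nat.succ '' recoilSet π) := by
  ext v
  simp only [mem_recoilSet, Set.mem_image, Set.mem_insert_iff]
  rcases lt_or_ge v n with hv | hv
  · rw [pos_psiR _ hv.le, pos_psiR _ hv]
    cases v with
    | zero => simpa using pos_lt π hv
    | succ v => simp
  · constructor
    · intro h
      have := recoil_lt h
      omega
    · rintro (rfl | ⟨u, hu, rfl⟩)
      · omega
      · have := recoil_lt hu
        omega

lemma exists_psiR {n : ℕ} {π : Perm (Fin (n + 1))} (h : pos π 0 = n) : ∃ σ, psiR σ = π :=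
  exists_insertion π ((pos_eq_iff π (Fin.last n) 0).1 h)

lemma hasIdSuffix_psiR {n : ℕ} (π : Perm (Fin n)) : HasIdSuffix (psiR π) :=
  hasIdSuffix_iff.2 ⟨1, le_rfl, by omega, fun c hc => by
    obtain rfl : c = 0 := by omega
    rw [pos_psiR π (by omega)]; simp⟩

/-! ### The operator `ψ_s` -/

lemma psiS_eq {n t : ℕ} {π : Perm (Fin n)} (ht : 1 ≤ t) (htn : t ≤ n)
    (h : ∀ c < t, pos π c = n - t + c) :
    psiS π = insertion ⟨t, by omega⟩ (Fin.last n) π := by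
  obtain ⟨m, rfl⟩ : ∃ m, n = m + 1 := ⟨n - 1, by omega⟩
  have h1 : pos π (⟨t - 1, by omega⟩ : Fin (m + 1)) = (Fin.last m : ℕ) := by
    rw [h (t - 1) (by omega), Fin.val_last]; omega
  rw [psiS, (pos_eq_iff π _ _).1 h1]
  congr 1
  ext
  simp only [Fin.val_succ]
  omega

lemma pos_psiS {n t : ℕ} {π : Perm (Fin n)} (ht : 1 ≤ t) (htn : t ≤ n)
    (h : ∀ c < t, pos π c = n - t + c) {v : ℕ} (hv : v ≤ n) :
    pos (psiS π) v = if v = t then n else if v < t then pos π v else pos π (v - 1) := by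
  rw [psiS_eq ht htn h, pos_insertion_last _ _ hv]

lemma pos_psiS_suffix {n t : ℕ} {π : Perm (Fin n)} (ht : 1 ≤ t) (htn : t ≤ n)
    (h : ∀ c < t, pos π c = n - t + c) :
    ∀ c < t + 1, pos (psiS π) c = n + 1 - (t + 1) + c := by
  intro c hc
  rw [pos_psiS ht htn h (by omega)]
  have := h c
  split_ifs <;> omega

lemma psiS_mem_evil_iff {n : ℕ} {π : Perm (Fin n)} (hs : HasIdSuffix π) :
    (⟨n + 1, psiS π⟩ : SizedPerm) ∈ Evil ↔ (⟨n, π⟩ : SizedPerm) ∈ Evil := by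
  obtain ⟨t, ht, htn, h⟩ := hasIdSuffix_iff.1 hs
  rw [mem_evil_iff_insertion_last (π := π) (i := ⟨t, by omega⟩), ← psiS_eq ht htn h]
  refine ⟨fun h => (mem_evil_iff.1 h).mono (Set.subset_univ _), fun h' => mem_evil_of_compl h' ?_⟩
  -- the values below the new last value `t` are in increasing order after all greater values
  intro a b c d hab hbc hcd hd hi hB
  have ha := pos_psiS_suffix ht htn h a
  have hb := pos_psiS_suffix ht htn h b
  have hc := pos_psiS_suffix ht htn h c
  have hd := pos_psiS_suffix ht htn h d
  have ha' := pos_lt (psiS π) (v := a) (by omega)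
  have hb' := pos_lt (psiS π) (v := b) (by omega)
  have hc' := pos_lt (psiS π) (v := c) (by omega)
  have hd' := pos_lt (psiS π) (v := d) (by omega)
  have htt := pos_psiS_suffix ht htn h t
  have hge : ∀ v, t < v → v < n + 1 → pos (psiS π) v < n - t := by
    intro v hv hvn
    by_contra hlt
    have hl := pos_lt (psiS π) hvn
    have := pos_psiS_suffix ht htn h (pos (psiS π) v - (n - t)) (by omega)
    exact pos_ne (psiS π) (show pos (psiS π) v - (n - t) ≠ v by omega) (by omega)
  have ka := hge a
  have kb := hge b
  have kc := hge c
  have kd := hge d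
  unfold Bad at hB
  simp only at hi
  rcases hi with hi | hi | hi | hi <;> rcases hB with hB | hB | hB | hB <;> omega

lemma recoilSet_psiS {n : ℕ} {π : Perm (Fin n)} (hs : HasIdSuffix π) :
    recoilSet (psiS π) = Nat.succ '' recoilSet π := by
  obtain ⟨t, ht, htn, h⟩ := hasIdSuffix_iff.1 hs
  ext v
  simp only [mem_recoilSet, Set.mem_image]
  rcases lt_or_ge v n with hv | hv
  · have h1 := pos_psiS ht htn h hv.le
    have h2 := pos_psiS ht htn h (v := v + 1) hv
    have hlt := pos_lt π hv
    have hlt' := pos_lt π (v := v - 1) (by omega)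
    have e1 := h v
    have e2 := h (v + 1)
    have e3 := h (v - 1)
    cases v with
    | zero =>
      simp only [reduceCtorEq, and_false, exists_false, iff_false]
      split_ifs at h1 h2 <;> omega
    | succ v =>
      simp only [Nat.succ_inj, exists_eq_right]
      simp only [Nat.add_sub_cancel] at h1 h2 e3 hlt'
      have hne := pos_ne π (show v + 1 ≠ v by omega)
      split_ifs at h1 h2 <;> omega
  · constructor
    · intro h
      have := recoil_lt h
      omega
    · rintro ⟨u, hu, rfl⟩
      have := recoil_lt hu
      omega

lemma hasIdSuffix_psiS {n : ℕ} {π : Perm (Fin n)} (hs : HasIdSuffix π) :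
    HasIdSuffix (psiS π) := by
  obtain ⟨t, ht, htn, h⟩ := hasIdSuffix_iff.1 hs
  exact hasIdSuffix_iff.2 ⟨t + 1, by omega, by omega, pos_psiS_suffix ht htn h⟩

lemma pos_psiS_zero_lt {n : ℕ} {π : Perm (Fin n)} (hs : HasIdSuffix π) : pos (psiS π) 0 < n := by
  obtain ⟨t, ht, htn, h⟩ := hasIdSuffix_iff.1 hs
  have := pos_psiS_suffix ht htn h 0
  omega

lemma psiS_injective {n : ℕ} {π σ : Perm (Fin n)} (hπ : HasIdSuffix π) (hσ : HasIdSuffix σ)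
    (h : psiS π = psiS σ) : π = σ := by
  obtain ⟨t, ht, htn, h1⟩ := hasIdSuffix_iff.1 hπ
  obtain ⟨t', ht', htn', h1'⟩ := hasIdSuffix_iff.1 hσ
  obtain rfl : t = t' := by
    apply pos_injective (psiS π)
    rw [pos_psiS_suffix ht htn h1 t (by omega), h, pos_psiS_suffix ht' htn' h1' t' (by omega)]
    omega
  rw [psiS_eq ht htn h1, psiS_eq ht' htn' h1'] at h
  exact insertion_last_injective _ h

lemma exists_psiS {n : ℕ} {π : Perm (Fin (n + 1))} (hs : HasIdSuffix π) (h0 : pos π 0 < n) :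
    ∃ σ, HasIdSuffix σ ∧ psiS σ = π := by
  obtain ⟨t, ht, htn, h⟩ := hasIdSuffix_iff.1 hs
  have h00 := h 0 ht
  have hlast : pos π (⟨t - 1, by omega⟩ : Fin (n + 1)) = (Fin.last n : ℕ) := by
    rw [h (t - 1) (by omega), Fin.val_last]; omega
  obtain ⟨σ, hσ⟩ := exists_insertion π ((pos_eq_iff π _ _).1 hlast)
  have hp : ∀ c < t - 1, pos σ c = n - (t - 1) + c := by
    intro c hc
    have := h c (by omega)
    rw [← hσ, pos_insertion_last _ _ (by omega), if_neg (by simp only; omega), if_pos hc] at this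
    omega
  refine ⟨σ, hasIdSuffix_iff.2 ⟨t - 1, by omega, by omega, hp⟩, ?_⟩
  rw [psiS_eq (by omega) (by omega) hp, hσ]

/-! ### The operator `ψ_q` -/

/-- With respect to the positions `f`, the value `T - 1` (with `T ≥ 1`) is the least recoil: the
values below `T` are in increasing order, and `T` precedes `T - 1`. -/
def IsLeastDrop (f : ℕ → ℕ) (T : ℕ) : Prop :=
  1 ≤ T ∧ (∀ u v, u < v → v < T → f u < f v) ∧ f T < f (T - 1)

lemma IsLeastDrop.eq {f : ℕ → ℕ} {T T' : ℕ} (h : IsLeastDrop f T) (h' : IsLeastDrop f T') :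
    T = T' := by
  obtain ⟨h1, h2, h3⟩ := h
  obtain ⟨h1', h2', h3'⟩ := h'
  rcases lt_trichotomy T T' with hT | hT | hT
  · have := h2' (T - 1) T (by omega) hT; omega
  · exact hT
  · have := h2 (T' - 1) T' (by omega) hT; omega

lemma exists_isLeastDrop {f : ℕ → ℕ} (hf : f.Injective) {v : ℕ} (h : f (v + 1) < f v) :
    ∃ T ≤ v + 1, IsLeastDrop f T := by
  classical
  have hex : ∃ v, f (v + 1) < f v := ⟨v, h⟩
  refine ⟨Nat.find hex + 1, by have := Nat.find_min' hex h; omega, by omega, ?_, Nat.find_spec hex⟩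
  intro u w huw hw
  refine lt_of_forall_succ (m := Nat.find hex + 1) (fun x hx => ?_) huw hw
  exact lt_of_le_of_ne (not_lt.1 (Nat.find_min hex (by omega))) (hf.ne (by omega))

lemma isLeastDrop_min {n : ℕ} {π : Perm (Fin n)} (h : (recoils π).Nonempty) :
    IsLeastDrop (pos π) ((recoils π).min' h + 1) := by
  have hmem := mem_recoils_iff.1 ((recoils π).min'_mem h)
  refine ⟨by omega, fun u w huw hw => ?_, hmem⟩
  refine lt_of_forall_succ (m := (recoils π).min' h + 1) (fun x hx => ?_) huw hw
  by_contra hlt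
  have hx' : x < n := by omega
  have hr : (⟨x, hx'⟩ : Fin n) ∈ recoils π :=
    mem_recoils_iff.2 (lt_of_le_of_ne (not_lt.1 hlt) (pos_ne π (by simp)))
  have := (recoils π).min'_le _ hr
  rw [Fin.le_def] at this
  simp only at this
  omega

lemma IsLeastDrop.lt {n T : ℕ} {π : Perm (Fin n)} (h : IsLeastDrop (pos π) T) : T < n := by
  have h1 := h.1
  have := recoil_lt (π := π) (v := T - 1) (by rw [Nat.sub_add_cancel h1]; exact h.2.2)
  omega

lemma IsLeastDrop.recoils_nonempty {n T : ℕ} {π : Perm (Fin n)} (h : IsLeastDrop (pos π) T) :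
    (recoils π).Nonempty :=
  recoils_nonempty_iff.2 ⟨T - 1, by rw [Nat.sub_add_cancel h.1]; exact h.2.2⟩

lemma IsSandwiched.isLeastDrop {n a b : ℕ} {π : Perm (Fin n)} (h : IsSandwiched π a b)
    (hn : a + b < n) : IsLeastDrop (pos π) (a + b) := by
  obtain ⟨hb, hab, h1, h2⟩ := isSandwiched_iff.1 h
  have h3 : ∀ v, a ≤ v → v < a + b → pos π v = n - b + (v - a) := by
    intro v hv hv'
    have := h2 (v - a) (by omega)
    rwa [Nat.add_sub_cancel' hv] at this
  refine ⟨by omega, fun u v huv hv => ?_, ?_⟩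
  · have := h1 u
    have := h1 v
    have := h3 u
    have := h3 v
    omega
  · have e1 := h3 (a + b - 1) (by omega) (by omega)
    have e2 := pos_lt π hn
    have e3 := pos_ne π (show a + b ≠ a + b - 1 by omega)
    omega

lemma IsSandwiched.add_lt {n a b T : ℕ} {π : Perm (Fin n)} (h : IsSandwiched π a b)
    (hT : IsLeastDrop (pos π) T) : a + b < n := by
  obtain ⟨hb, hab, h1, h2⟩ := isSandwiched_iff.1 h
  refine lt_of_le_of_ne hab fun hn => ?_
  have h3 : ∀ v, v < n → pos π v = v := by
    intro v hv
    rcases lt_or_ge v a with hva | hva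
    · exact h1 v hva
    · have := h2 (v - a) (by omega)
      rw [Nat.add_sub_cancel' hva] at this
      omega
  have := hT.lt
  have := h3 T hT.lt
  have := h3 (T - 1) (by omega)
  have := hT.2.2
  omega

lemma IsSandwiched.add_eq {n a b T : ℕ} {π : Perm (Fin n)} (h : IsSandwiched π a b)
    (hT : IsLeastDrop (pos π) T) : a + b = T :=
  (h.isLeastDrop (h.add_lt hT)).eq hT

lemma IsSandwiched.unique {n a b a' b' T : ℕ} {π : Perm (Fin n)} (h : IsSandwiched π a b)
    (h' : IsSandwiched π a' b') (hT : IsLeastDrop (pos π) T) : a = a' ∧ b = b' := by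
  have e1 := h.add_eq hT
  have e2 := h'.add_eq hT
  have e3 := h.add_lt hT
  obtain ⟨hb, hab, h1, h2⟩ := isSandwiched_iff.1 h
  obtain ⟨hb', hab', h1', h2'⟩ := isSandwiched_iff.1 h'
  have k1 := h1 a'
  have k2 := h2 0
  have k3 := h1' a
  have k4 := h2' 0
  simp only [Nat.add_zero] at k2 k4
  omega

lemma psiQ_of_not_sandwiched {n T : ℕ} {π : Perm (Fin n)} (hT : IsLeastDrop (pos π) T)
    (hs : ¬ ∃ a b, IsSandwiched π a b) :
    psiQ π = insertion ⟨T, hT.lt.trans (Nat.lt_succ_self n)⟩ 0 π := by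
  have hne := hT.recoils_nonempty
  have e := (isLeastDrop_min hne).eq hT
  have hs' : ¬ ∃ ab : ℕ × ℕ, IsSandwiched π ab.1 ab.2 := fun ⟨ab, h⟩ => hs ⟨ab.1, ab.2, h⟩
  rw [psiQ, dif_pos hne, dif_neg hs']
  congr 1
  ext
  simpa using e

lemma psiQ_of_sandwiched {n T a b : ℕ} {π : Perm (Fin n)} (hT : IsLeastDrop (pos π) T)
    (hs : IsSandwiched π a b) :
    psiQ π = shifting ⟨n - b + 1, by have := hs.1; have := hs.2.1; omega⟩
      ⟨a + 1, by have := hs.1; have := hs.2.1; omega⟩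
      (insertion ⟨T, hT.lt.trans (Nat.lt_succ_self n)⟩ 0 π) := by
  have hne := hT.recoils_nonempty
  have e := (isLeastDrop_min hne).eq hT
  have hs' : ∃ ab : ℕ × ℕ, IsSandwiched π ab.1 ab.2 := ⟨(a, b), hs⟩
  obtain ⟨e1, e2⟩ := hs'.choose_spec.unique hs hT
  have e3 : ((recoils π).min' hne).succ = ⟨T, hT.lt.trans (Nat.lt_succ_self n)⟩ := by
    ext; simpa using e
  rw [psiQ, dif_pos hne, dif_pos hs', e3]
  simp only [e1, e2]

/-- `π` begins with `T, 0, 1, …, a - 1` and ends with `a, …, T - 1`, where `1 ≤ a ≤ T`, and the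
greatest value is not `T`. These are the values of `ψ_q` at sandwiched permutations. -/
def IsTwisted {n : ℕ} (π : Perm (Fin n)) (T a : ℕ) : Prop :=
  pos π T = 0 ∧ 1 ≤ a ∧ a ≤ T ∧ T + 1 < n ∧ (∀ v < a, pos π v = v + 1) ∧
    ∀ v < T, a ≤ v → pos π v = n - T + v

lemma IsTwisted.unique {n T a a' : ℕ} {π : Perm (Fin n)} (h : IsTwisted π T a)
    (h' : IsTwisted π T a') : a = a' := by
  obtain ⟨-, h1, h2, h3, h4, h5⟩ := h
  obtain ⟨-, h1', h2', h3', h4', h5'⟩ := h'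
  rcases lt_trichotomy a a' with ha | ha | ha
  · have := h4' a ha
    have := h5 a (by omega) le_rfl
    omega
  · exact ha
  · have := h4 a' ha
    have := h5' a' (by omega) le_rfl
    omega

lemma IsSandwiched.pos_of_ge {n a b : ℕ} {π : Perm (Fin n)} (h : IsSandwiched π a b) {v : ℕ}
    (hv : a ≤ v) (hv' : v < a + b) : pos π v = n - b + (v - a) := by
  have := (isSandwiched_iff.1 h).2.2.2 (v - a) (by omega)
  rwa [Nat.add_sub_cancel' hv] at this

lemma pos_front_of_sandwiched {n a b : ℕ} {σ : Perm (Fin n)} {T : Fin (n + 1)}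
    (hs : IsSandwiched σ a b) (hT : (T : ℕ) = a + b) :
    pos (insertion T 0 σ) T = 0 ∧ (∀ v < a, pos (insertion T 0 σ) v = v + 1) ∧
      ∀ v, a ≤ v → v < a + b → pos (insertion T 0 σ) v = n - b + (v - a) + 1 := by
  have h1 := (isSandwiched_iff.1 hs).2.2.1
  refine ⟨pos_insertion_self _ _ _, fun v hv => ?_, fun v hv hv' => ?_⟩
  · rw [pos_insertion_zero, if_neg (by omega), if_pos (by omega), h1 v hv]
  · rw [pos_insertion_zero, if_neg (by omega), if_pos (by omega), hs.pos_of_ge hv hv']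

/-- In the situation of a sandwiched permutation, the shift that is part of `ψ_q` moves exactly the
value `a`. -/
lemma pos_shift_of_sandwiched {n a b : ℕ} {σ : Perm (Fin n)} {T c d : Fin (n + 1)}
    (hs : IsSandwiched σ a b) (hT : (T : ℕ) = a + b) (hc : (c : ℕ) = n - b + 1)
    (hd : (d : ℕ) = a + 1) :
    pos (shifting c d (insertion T 0 σ)) a = a + 1 ∧
    ∀ v, v ≠ a → pos (shifting c d (insertion T 0 σ)) v =
      if a + 1 ≤ pos (insertion T 0 σ) v ∧ pos (insertion T 0 σ) v < n - b + 1
        then pos (insertion T 0 σ) v + 1 else pos (insertion T 0 σ) v := by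
  obtain ⟨h0, h1, h2⟩ := pos_front_of_sandwiched hs hT
  have hb := hs.1
  have hab := hs.2.1
  have ha := h2 a le_rfl (by omega)
  have hle : d ≤ c := by rw [Fin.le_def]; omega
  refine ⟨?_, fun v hv => ?_⟩
  · rw [pos_shifting hle, if_pos (by omega), hd]
  · have := pos_ne (insertion T 0 σ) hv
    rw [pos_shifting hle, if_neg (by omega), hc, hd]

lemma isTwisted_shift {n a b : ℕ} {σ : Perm (Fin n)} {T c d : Fin (n + 1)}
    (hs : IsSandwiched σ a b) (hn : a + b < n) (hT : (T : ℕ) = a + b) (hc : (c : ℕ) = n - b + 1)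
    (hd : (d : ℕ) = a + 1) : IsTwisted (shifting c d (insertion T 0 σ)) T (a + 1) := by
  obtain ⟨h0, h1, h2⟩ := pos_front_of_sandwiched hs hT
  obtain ⟨h3, h4⟩ := pos_shift_of_sandwiched hs hT hc hd
  have hb := hs.1
  refine ⟨?_, by omega, by omega, by omega, fun v hv => ?_, fun v hv hv' => ?_⟩
  · rw [h4 _ (by omega), if_neg (by omega), h0]
  · rcases eq_or_ne v a with rfl | hva
    · exact h3
    · rw [h4 v hva, h1 v (by omega), if_neg (by omega)]
  · rw [h4 v (by omega), h2 v (by omega) (by omega), if_neg (by omega)]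
    omega

/-- Every twisted permutation comes from a sandwiched one by insertion and shift. -/
lemma IsTwisted.exists_sandwiched {n T a : ℕ} {π : Perm (Fin (n + 1))} (h : IsTwisted π T a) :
    ∃ (σ : Perm (Fin n)) (T' c d : Fin (n + 1)), (T' : ℕ) = T ∧
      (c : ℕ) = n - (T - (a - 1)) + 1 ∧ (d : ℕ) = a ∧ IsSandwiched σ (a - 1) (T - (a - 1)) ∧
      shifting c d (insertion T' 0 σ) = π := by
  obtain ⟨h0, ha, haT, hTn, h1, h2⟩ := h
  let c : Fin (n + 1) := ⟨n - (T - (a - 1)) + 1, by omega⟩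
  let d : Fin (n + 1) := ⟨a, by omega⟩
  let T' : Fin (n + 1) := ⟨T, by omega⟩
  have hc : (c : ℕ) = n - (T - (a - 1)) + 1 := rfl
  have hd : (d : ℕ) = a := rfl
  have hle : d ≤ c := by rw [Fin.le_def]; omega
  have hπ := shifting_shifting c d π
  set τ := shifting d c π with hτ
  have hp := pos_shifting hle τ
  rw [hπ, hc, hd] at hp
  have t0 : pos τ T = 0 := by
    have := hp T
    split_ifs at this <;> omega
  have t1 : ∀ v < a - 1, pos τ v = v + 1 := by
    intro v hv
    have := hp v
    have := h1 v (by omega)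
    split_ifs at * <;> omega
  have t2 : ∀ v, a - 1 ≤ v → v < T → pos τ v = n - T + v + 1 := by
    intro v hv hv'
    have := hp v
    rcases eq_or_ne v (a - 1) with rfl | hva
    · have := h1 (a - 1) (by omega)
      split_ifs at * <;> omega
    · have := h2 v hv' (by omega)
      split_ifs at * <;> omega
  obtain ⟨σ, hσ⟩ := exists_insertion τ (i := T') ((pos_eq_iff τ 0 T').1 t0)
  refine ⟨σ, T', c, d, rfl, rfl, rfl, ?_, by rw [hσ, hπ]⟩
  have hq : ∀ v, v < T → pos τ v = pos σ v + 1 := by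
    intro v hv
    rw [← hσ, pos_insertion_zero, if_neg (by simp only [T']; omega), if_pos hv]
  refine isSandwiched_iff.2 ⟨by omega, by omega, fun i hi => ?_, fun e he => ?_⟩
  · have := hq i (by omega)
    have := t1 i hi
    omega
  · have := hq (a - 1 + e) (by omega)
    have := t2 (a - 1 + e) (by omega) (by omega)
    omega

/-- No forbidden pattern uses the value `T` if `T` comes first, the values below it are in
increasing order, and `T + 1` precedes `T - 1`: such a pattern would yield one that avoids `T`
and uses `T + 1` or `T - 1`. -/
lemma not_bad_of_front {N T : ℕ} {f : ℕ → ℕ} (hf : f.Injective) (hT : T + 1 < N) (h0 : f T = 0)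
    (hinc : ∀ u v, u < v → v < T → f u < f v) (hdrop : f (T + 1) < f (T - 1))
    (h : NoBad N {T}ᶜ f) {a b c d : ℕ} (hab : a < b) (hbc : b < c) (hcd : c < d) (hd : d < N)
    (hi : a = T ∨ b = T ∨ c = T ∨ d = T) : ¬ Bad f a b c d := by
  intro hB
  have hmem : ∀ v, v ≠ T → v ∈ ({T}ᶜ : Set ℕ) := fun v hv => by simpa using hv
  have e1 := hinc a b
  have e2 := hinc b c
  rcases hi with hi | hi | hi | hi
  · unfold Bad at hB; subst hi; omega
  · subst hi
    -- Being in front, `T` can only be the first entry of a pattern `2413`. Depending on where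
    -- `T + 1` is, it takes the place of `T` or it forms the pattern `4132` with `d`, `a`, `T - 1`.
    have hB' : f d < f a ∧ f a < f c := by unfold Bad at hB; omega
    rcases lt_or_ge (f (b + 1)) (f a) with hlt | hge
    · rcases eq_or_ne c (b + 1) with rfl | hne
      · omega
      · have := h a (b + 1) c d (by omega) (by omega) hcd hd (hmem _ (by omega))
          (hmem _ (by omega)) (hmem _ (by omega)) (hmem _ (by omega))
        unfold Bad at this
        have h3 := hf.ne (show b + 1 ≠ d by omega)
        omega
    · have h1 := hf.ne (show b + 1 ≠ a by omega)
      have h2 : a ≠ b - 1 := by rintro rfl; omega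
      have := h a (b - 1) (b + 1) d (by omega) (by omega) (by omega) hd (hmem _ (by omega))
          (hmem _ (by omega)) (hmem _ (by omega)) (hmem _ (by omega))
      unfold Bad at this
      omega
  · unfold Bad at hB; subst hi; omega
  · unfold Bad at hB; subst hi; omega

lemma mem_evil_front {n : ℕ} {T : Fin (n + 1)} {σ : Perm (Fin n)} (hT : IsLeastDrop (pos σ) T)
    (hσ : (⟨n, σ⟩ : SizedPerm) ∈ Evil) : (⟨n + 1, insertion T 0 σ⟩ : SizedPerm) ∈ Evil := by
  have h := (mem_evil_iff_insertion_zero (i := T)).1 hσ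
  refine mem_evil_of_compl h fun a b c d hab hbc hcd hd hi => ?_
  have hTn := hT.lt
  obtain ⟨hT1, hinc, hdrop⟩ := hT
  refine not_bad_of_front (pos_injective _) (by omega) (pos_insertion_self _ _ _) ?_ ?_
    h hab hbc hcd hd hi
  · intro u v huv hv
    have := hinc u v huv hv
    simp only [pos_insertion_zero]
    split_ifs <;> omega
  · simp only [pos_insertion_zero, Nat.add_sub_cancel]
    split_ifs <;> omega

lemma noBad_congr {N : ℕ} {S : Set ℕ} {f g : ℕ → ℕ}
    (h : ∀ u v, u ∈ S → v ∈ S → (f u < f v ↔ g u < g v)) : NoBad N S f ↔ NoBad N S g := by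
  refine forall_congr' fun a => forall_congr' fun b => forall_congr' fun c => forall_congr' fun d =>
    forall_congr' fun _ => forall_congr' fun _ => forall_congr' fun _ => forall_congr' fun _ =>
    forall_congr' fun ha => forall_congr' fun hb => forall_congr' fun hc => forall_congr' fun hd =>
    ?_
  unfold Bad
  rw [h b d hb hd, h d a hd ha, h a c ha hc, h c b hc hb, h d b hd hb, h b a hb ha, h a d ha hd]

/-- The shift does not change the relative order of the values other than the moved value `a`. -/
lemma shift_lt_iff {n a b : ℕ} {σ : Perm (Fin n)} {T c d : Fin (n + 1)}
    (hs : IsSandwiched σ a b) (hT : (T : ℕ) = a + b) (hc : (c : ℕ) = n - b + 1)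
    (hd : (d : ℕ) = a + 1) (u v : ℕ) (hu : u ≠ a) (hv : v ≠ a) :
    pos (shifting c d (insertion T 0 σ)) u < pos (shifting c d (insertion T 0 σ)) v ↔
      pos (insertion T 0 σ) u < pos (insertion T 0 σ) v := by
  obtain ⟨h0, h1, h2⟩ := pos_front_of_sandwiched hs hT
  obtain ⟨h3, h4⟩ := pos_shift_of_sandwiched hs hT hc hd
  have ha := h2 a le_rfl (by have := hs.1; omega)
  have := pos_ne (insertion T 0 σ) hu
  have := pos_ne (insertion T 0 σ) hv
  rw [h4 u hu, h4 v hv]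
  split_ifs <;> omega

lemma IsTwisted.pos_mid {n T a : ℕ} {π : Perm (Fin n)} (h : IsTwisted π T a) {v : ℕ}
    (hv : T < v) (hvn : v < n) : a < pos π v ∧ pos π v < n - T + a := by
  obtain ⟨h0, ha, haT, hTn, h1, h2⟩ := h
  have hlt := pos_lt π hvn
  constructor
  · by_contra hle
    rcases Nat.eq_zero_or_pos (pos π v) with hz | hp
    · exact pos_ne π (show v ≠ T by omega) (by omega)
    · have := h1 (pos π v - 1) (by omega)
      exact pos_ne π (show v ≠ pos π v - 1 by omega) (by omega)
  · by_contra hle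
    have := h2 (pos π v - (n - T)) (by omega) (by omega)
    exact pos_ne π (show v ≠ pos π v - (n - T) by omega) (by omega)

/-- In a twisted permutation `T, 0, …, a - 1, …` no forbidden pattern uses the value `a - 1`. -/
lemma IsTwisted.not_bad {n T e : ℕ} {π : Perm (Fin n)} (h : IsTwisted π T (e + 1)) {a b c d : ℕ}
    (hab : a < b) (hbc : b < c) (hcd : c < d) (hd : d < n)
    (hi : a = e ∨ b = e ∨ c = e ∨ d = e) : ¬ Bad (pos π) a b c d := by
  intro hB
  have key : ∀ v, v < n → (v ≤ e ∧ pos π v = v + 1) ∨ (e < v ∧ v < T ∧ pos π v = n - T + v) ∨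
      (v = T ∧ pos π v = 0) ∨ (T < v ∧ e + 1 < pos π v ∧ pos π v < n - T + (e + 1)) := by
    intro v hv
    rcases lt_trichotomy v T with hvT | rfl | hvT
    · rcases lt_or_ge v (e + 1) with hve | hve
      · exact Or.inl ⟨by omega, h.2.2.2.2.1 v hve⟩
      · exact Or.inr (Or.inl ⟨by omega, hvT, h.2.2.2.2.2 v hvT hve⟩)
    · exact Or.inr (Or.inr (Or.inl ⟨rfl, h.1⟩))
    · exact Or.inr (Or.inr (Or.inr ⟨hvT, h.pos_mid hvT hv⟩))
  have ka := key a (by omega)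
  have kb := key b (by omega)
  have kc := key c (by omega)
  have kd := key d hd
  have := h.2.2.1
  have := h.2.2.2.1
  clear key h
  unfold Bad at hB
  rcases hi with rfl | rfl | rfl | rfl <;> rcases hB with hB | hB | hB | hB <;> omega

/-- If the first entry `T` is put in front of a sandwiched permutation, then no forbidden pattern
that avoids `T` uses the value `a`. -/
lemma not_bad_front_of_sandwiched {n e m : ℕ} {σ : Perm (Fin n)} {T : Fin (n + 1)}
    (hs : IsSandwiched σ e m) (hn : e + m < n) (hT : (T : ℕ) = e + m) {a b c d : ℕ}
    (hab : a < b) (hbc : b < c) (hcd : c < d) (hd : d < n + 1)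
    (haT : a ≠ T) (hbT : b ≠ T) (hcT : c ≠ T) (hdT : d ≠ T)
    (hi : a = e ∨ b = e ∨ c = e ∨ d = e) : ¬ Bad (pos (insertion T 0 σ)) a b c d := by
  obtain ⟨h0, h1, h2⟩ := pos_front_of_sandwiched hs hT
  have hm := hs.1
  generalize insertion T 0 σ = π at *
  intro hB
  have key : ∀ v, v < n + 1 → v ≠ T → (v < e ∧ pos π v = v + 1) ∨
      (e ≤ v ∧ v < e + m ∧ pos π v = n - m + (v - e) + 1) ∨
      (e + m < v ∧ e < pos π v ∧ pos π v < n - m + 1) := by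
    intro v hv hvT
    rcases lt_or_ge v e with hve | hve
    · exact Or.inl ⟨hve, h1 v hve⟩
    · rcases lt_or_ge v (e + m) with hvm | hvm
      · exact Or.inr (Or.inl ⟨hve, hvm, h2 v hve hvm⟩)
      · refine Or.inr (Or.inr ⟨by omega, ?_, ?_⟩)
        · by_contra hle
          rcases Nat.eq_zero_or_pos (pos π v) with hz | hp
          · exact pos_ne π hvT (by omega)
          · have := h1 (pos π v - 1) (by omega)
            exact pos_ne π (show v ≠ pos π v - 1 by omega) (by omega)
        · by_contra hle
          have hlt := pos_lt π hv
          have := h2 (pos π v - 1 - (n - m) + e) (by omega) (by omega)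
          exact pos_ne π (show v ≠ pos π v - 1 - (n - m) + e by omega) (by omega)
  have ka := key a (by omega) haT
  have kb := key b (by omega) hbT
  have kc := key c (by omega) hcT
  have kd := key d hd hdT
  clear key h0 h1 h2 hs
  unfold Bad at hB
  rcases hi with rfl | rfl | rfl | rfl <;> rcases hB with hB | hB | hB | hB <;> omega

/-- The shift preserves and reflects evil-avoidance, since neither before nor after it the moved
value belongs to a forbidden pattern. -/
lemma mem_evil_shift_iff {n a b : ℕ} {σ : Perm (Fin n)} {T c d : Fin (n + 1)}
    (hs : IsSandwiched σ a b) (hn : a + b < n) (hT : (T : ℕ) = a + b) (hc : (c : ℕ) = n - b + 1)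
    (hd : (d : ℕ) = a + 1) :
    (⟨n + 1, shifting c d (insertion T 0 σ)⟩ : SizedPerm) ∈ Evil ↔
      (⟨n, σ⟩ : SizedPerm) ∈ Evil := by
  have htw := isTwisted_shift hs hn hT hc hd
  have hlt := shift_lt_iff hs hT hc hd
  have hcongr : ∀ S : Set ℕ, a ∉ S →
      (NoBad (n + 1) S (pos (shifting c d (insertion T 0 σ))) ↔
        NoBad (n + 1) S (pos (insertion T 0 σ))) := fun S hS =>
    noBad_congr fun u v hu hv => hlt u v (fun h => hS (h ▸ hu)) (fun h => hS (h ▸ hv))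
  constructor
  · intro h
    rw [mem_evil_iff_insertion_zero (i := T)]
    refine noBad_of_compl (i := a) ?_ ?_
    · rw [← hcongr _ (by simp)]
      exact (mem_evil_iff.1 h).mono (Set.subset_univ _)
    · intro x y z w hxy hyz hzw hw hx hy hz hw' hi
      exact not_bad_front_of_sandwiched hs hn hT hxy hyz hzw hw (by simpa using hx)
        (by simpa using hy) (by simpa using hz) (by simpa using hw') hi
  · intro h
    have hdrop := hs.isLeastDrop hn
    rw [← hT] at hdrop
    refine mem_evil_of_compl (i := a) ?_ fun x y z w hxy hyz hzw hw hi =>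
      htw.not_bad hxy hyz hzw hw hi
    rw [hcongr _ (by simp)]
    exact (mem_evil_iff.1 (mem_evil_front hdrop h)).mono (Set.subset_univ _)

lemma skip_injective (T : ℕ) : Function.Injective fun u : ℕ => if u < T then u else u + 1 := by
  intro u v h
  simp only at h
  split_ifs at h <;> omega

lemma recoilSet_front {n : ℕ} {T : Fin (n + 1)} {σ : Perm (Fin n)} (hT : IsLeastDrop (pos σ) T) :
    recoilSet (insertion T 0 σ) = (fun u => if u < (T : ℕ) then u else u + 1) '' recoilSet σ := by
  obtain ⟨h1, h2, h3⟩ := hT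
  ext v
  simp only [mem_recoilSet, Set.mem_image]
  constructor
  · intro hv
    refine ⟨if v < T then v else v - 1, ?_, ?_⟩
    · rw [pos_insertion_zero, pos_insertion_zero] at hv
      rcases lt_trichotomy v T with hvT | hvT | hvT
      · rw [if_pos hvT]
        rcases eq_or_ne (v + 1) T with hv1 | hv1
        · rw [← hv1] at h3
          exact h3
        · have := h2 v (v + 1) (by omega) (by omega)
          rw [if_neg hv1, if_pos (by omega), if_neg (by omega), if_pos hvT] at hv
          omega
      · rw [if_pos hvT] at hv; omega
      · rw [if_neg (by omega), Nat.sub_add_cancel (by omega)]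
        rw [if_neg (by omega), if_neg (by omega), if_neg (by omega), if_neg (by omega)] at hv
        simpa using hv
    · rcases lt_trichotomy v T with hvT | hvT | hvT
      · rw [if_pos hvT, if_pos hvT]
      · rw [hvT, pos_insertion_self] at hv; simp at hv
      · rw [if_neg (show ¬ v < T by omega), if_neg (by omega)]; omega
  · rintro ⟨u, hu, rfl⟩
    rcases lt_trichotomy (u + 1) T with huT | huT | huT
    · have := h2 u (u + 1) (by omega) huT
      omega
    · rw [if_pos (by omega), pos_insertion_zero, if_pos huT, pos_insertion_zero,
        if_neg (by omega), if_pos (by omega)]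
      omega
    · rw [if_neg (by omega), pos_insertion_zero, if_neg (by omega), if_neg (by omega),
        pos_insertion_zero, if_neg (by omega), if_neg (by omega)]
      simpa using hu

lemma recoilSet_shift {n a b : ℕ} {σ : Perm (Fin n)} {T c d : Fin (n + 1)}
    (hs : IsSandwiched σ a b) (hn : a + b < n) (hT : (T : ℕ) = a + b) (hc : (c : ℕ) = n - b + 1)
    (hd : (d : ℕ) = a + 1) :
    recoilSet (shifting c d (insertion T 0 σ)) = recoilSet (insertion T 0 σ) := by
  have htw := isTwisted_shift hs hn hT hc hd
  obtain ⟨h0, h1, h2⟩ := pos_front_of_sandwiched hs hT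
  obtain ⟨h3, -⟩ := pos_shift_of_sandwiched hs hT hc hd
  obtain ⟨k0, -, -, -, k1, k2⟩ := htw
  have hb := hs.1
  ext v
  simp only [mem_recoilSet]
  by_cases hva : v = a
  · subst hva
    have e1 := h2 v le_rfl (by omega)
    rcases eq_or_ne b 1 with rfl | hb1
    · rw [← hT, k0, h0]
      omega
    · have e2 := h2 (v + 1) (by omega) (by omega)
      have e3 := k2 (v + 1) (by omega) (by omega)
      omega
  · by_cases hva' : v + 1 = a
    · have e1 := h1 v (by omega)
      have e2 := h2 a le_rfl (by omega)
      have e3 := k1 v (by omega)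
      rw [hva']
      omega
    · exact shift_lt_iff hs hT hc hd _ _ hva' hva

/-- The two cases in the definition of `ψ_q` are told apart by the result: it is twisted exactly if
the argument is sandwiched. -/
lemma psiQ_cases {n : ℕ} {σ : Perm (Fin n)} (h : (recoils σ).Nonempty) :
    ∃ T : Fin (n + 1), IsLeastDrop (pos σ) T ∧ pos (psiQ σ) T = 0 ∧
      (((¬ ∃ a b, IsSandwiched σ a b) ∧ (¬ ∃ a, IsTwisted (psiQ σ) T a) ∧
        psiQ σ = insertion T 0 σ) ∨
      ∃ (a b : ℕ) (c d : Fin (n + 1)), IsSandwiched σ a b ∧ a + b < n ∧ (T : ℕ) = a + b ∧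
        (c : ℕ) = n - b + 1 ∧ (d : ℕ) = a + 1 ∧ psiQ σ = shifting c d (insertion T 0 σ)) := by
  obtain ⟨t, hdrop⟩ : ∃ t, IsLeastDrop (pos σ) t := ⟨_, isLeastDrop_min h⟩
  have hlt := hdrop.lt
  refine ⟨⟨t, by omega⟩, hdrop, ?_⟩
  by_cases hs : ∃ a b, IsSandwiched σ a b
  · obtain ⟨a, b, hs⟩ := hs
    have e := hs.add_eq hdrop
    have heq := psiQ_of_sandwiched hdrop hs
    have hb := hs.1
    constructor
    · rw [heq]
      exact (isTwisted_shift (T := ⟨t, by omega⟩) (c := ⟨n - b + 1, by omega⟩)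
        (d := ⟨a + 1, by omega⟩) hs (by omega) e.symm rfl rfl).1
    · exact Or.inr ⟨a, b, _, _, hs, by omega, e.symm, rfl, rfl, heq⟩
  · have heq := psiQ_of_not_sandwiched hdrop hs
    refine ⟨by rw [heq]; exact pos_insertion_self _ _ _, Or.inl ⟨hs, ?_, heq⟩⟩
    rintro ⟨a, -, ha, haT, hTn, h1, h2⟩
    simp only at haT hTn h2
    have hq : ∀ v, v < t → pos (psiQ σ) v = pos σ v + 1 := by
      intro v hv
      rw [heq, pos_insertion_zero, if_neg (by simp only; omega), if_pos hv]
    rcases eq_or_lt_of_le haT with rfl | hat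
    · -- `σ` begins with `0, …, T - 1`, so that `T - 1` is not a recoil
      have := pos_lt σ hlt
      have h3 := hdrop.2.2
      have h4 := hq (a - 1) (by omega)
      have h5 := h1 (a - 1) (by omega)
      have h6 := hq (pos σ a) (by omega)
      have h7 := h1 (pos σ a) (by omega)
      exact pos_ne σ (show a ≠ pos σ a by omega) (by omega)
    · refine hs ⟨a, t - a, isSandwiched_iff.2 ⟨by omega, by omega, fun i hi => ?_, fun c hc => ?_⟩⟩
      · have := h1 i hi
        have := hq i (by omega)
        omega
      · have := h2 (a + c) (by omega) (by omega)
        have := hq (a + c) (by omega)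
        omega

lemma psiQ_mem_evil_iff {n : ℕ} {σ : Perm (Fin n)} (h : (recoils σ).Nonempty) :
    (⟨n + 1, psiQ σ⟩ : SizedPerm) ∈ Evil ↔ (⟨n, σ⟩ : SizedPerm) ∈ Evil := by
  obtain ⟨T, hdrop, -, ⟨-, -, heq⟩ | ⟨a, b, c, d, hs, hn, hT, hc, hd, heq⟩⟩ := psiQ_cases h
  · refine ⟨fun h => ?_, fun h => heq ▸ mem_evil_front hdrop h⟩
    rw [mem_evil_iff_insertion_zero (i := T), ← heq]
    exact (mem_evil_iff.1 h).mono (Set.subset_univ _)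
  · rw [heq, mem_evil_shift_iff hs hn hT hc hd]

lemma ncard_recoilSet_psiQ {n : ℕ} {σ : Perm (Fin n)} (h : (recoils σ).Nonempty) :
    (recoilSet (psiQ σ)).ncard = (recoilSet σ).ncard := by
  obtain ⟨T, hdrop, -, ⟨-, -, heq⟩ | ⟨a, b, c, d, hs, hn, hT, hc, hd, heq⟩⟩ := psiQ_cases h
  · rw [heq, recoilSet_front hdrop, Set.ncard_image_of_injective _ (skip_injective _)]
  · rw [heq, recoilSet_shift hs hn hT hc hd, recoilSet_front hdrop,
      Set.ncard_image_of_injective _ (skip_injective _)]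

lemma pos_psiQ_zero_ne {n : ℕ} {σ : Perm (Fin n)} (h : (recoils σ).Nonempty) :
    pos (psiQ σ) 0 ≠ 0 := by
  obtain ⟨T, hdrop, h0, -⟩ := psiQ_cases h
  have := pos_ne (psiQ σ) (show 0 ≠ (T : ℕ) from (Nat.one_le_iff_ne_zero.1 hdrop.1).symm)
  omega

lemma not_hasIdSuffix_psiQ {n : ℕ} {σ : Perm (Fin n)} (h : (recoils σ).Nonempty) :
    ¬ HasIdSuffix (psiQ σ) := by
  intro hs
  obtain ⟨m, hm, hmn, hsuf⟩ := hasIdSuffix_iff.1 hs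
  obtain ⟨T, hdrop, h0, ⟨hns, -, heq⟩ | ⟨a, b, c, d, hs, hn, hT, hc, hd, heq⟩⟩ := psiQ_cases h
  · have hT1 := hdrop.1
    have hTn := hdrop.lt
    have hmT : m ≤ T := by
      by_contra hlt
      have := hsuf T (by omega)
      omega
    refine hns ⟨0, m, isSandwiched_iff.2 ⟨hm, by omega, fun i hi => by omega, fun c hc => ?_⟩⟩
    have := hsuf c hc
    rw [heq, pos_insertion_zero, if_neg (by omega), if_pos (by omega)] at this
    rw [Nat.zero_add]
    omega
  · have htw := isTwisted_shift hs hn hT hc hd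
    rw [← heq] at htw
    have h1 := htw.2.2.2.2.1 0 (by omega)
    have h2 := hsuf 0 (by omega)
    have h3 := hsuf T
    omega

lemma psiQ_injective {n : ℕ} {σ σ' : Perm (Fin n)} (h : (recoils σ).Nonempty)
    (h' : (recoils σ').Nonempty) (heq : psiQ σ = psiQ σ') : σ = σ' := by
  obtain ⟨T, -, h0, hc⟩ := psiQ_cases h
  obtain ⟨T', -, h0', hc'⟩ := psiQ_cases h'
  obtain rfl : T = T' := by
    rw [← heq] at h0'
    exact Fin.ext (pos_injective _ (h0.trans h0'.symm))
  rcases hc with ⟨-, hnt, e⟩ | ⟨a, b, c, d, hs, hn, hT, hc, hd, e⟩ <;>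
    rcases hc' with ⟨-, hnt', e'⟩ | ⟨a', b', c', d', hs', hn', hT', hc', hd', e'⟩
  · rw [e, e'] at heq
    exact insertion_zero_injective T heq
  · refine absurd ⟨a' + 1, ?_⟩ hnt
    rw [heq, e']; exact isTwisted_shift hs' hn' hT' hc' hd'
  · refine absurd ⟨a + 1, ?_⟩ hnt'
    rw [← heq, e]; exact isTwisted_shift hs hn hT hc hd
  · have t1 := isTwisted_shift hs hn hT hc hd
    have t2 := isTwisted_shift hs' hn' hT' hc' hd'
    rw [← e', ← heq, e] at t2
    have ha := t1.unique t2
    obtain rfl : d = d' := Fin.ext (by omega)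
    obtain rfl : c = c' := Fin.ext (by omega)
    rw [e, e'] at heq
    refine insertion_zero_injective T ?_
    simpa [shifting_shifting] using congrArg (shifting d c) heq

/-- An evil-avoiding permutation that has no identity suffix and begins with `T ≠ 0` has `T - 1` as
its least recoil. -/
lemma isLeastDrop_of_pos_eq_zero {n T : ℕ} {π : Perm (Fin n)} (hπ : (⟨n, π⟩ : SizedPerm) ∈ Evil)
    (hs : ¬ HasIdSuffix π) (hT : 1 ≤ T) (hTn : T < n) (h0 : pos π T = 0) :
    IsLeastDrop (pos π) T := by
  have hnb := mem_evil_iff.1 hπ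
  simp only at hnb
  have hne := fun u v (h : u ≠ v) => pos_ne π h
  have hpos : ∀ v, v ≠ T → 0 < pos π v := fun v hv => by
    have := hne v T hv
    omega
  obtain ⟨S, hS, hdrop⟩ := exists_isLeastDrop (pos_injective π) (v := T - 1)
    (by rw [Nat.sub_add_cancel hT, h0]; exact hpos _ (by omega))
  rw [Nat.sub_add_cancel hT] at hS
  rcases eq_or_lt_of_le hS with rfl | hST
  · exact hdrop
  -- Otherwise the least recoil is `S - 1` with `S < T`, and the values below `S` form a suffix.
  obtain ⟨h1, hinc, hd⟩ := hdrop
  refine absurd (hasIdSuffix_of_order h1 (by omega) ?_ hinc) hs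
  have hpT := hpos S (by omega)
  have hS0 : pos π S < pos π 0 := by
    by_contra hle
    have := hne S 0 (by omega)
    have := hpos 0 (by omega)
    have h2 : S - 1 ≠ 0 := by intro h; rw [h] at hd; omega
    -- the pattern `4132`
    refine hnb 0 (S - 1) S T (by omega) (by omega) hST hTn trivial trivial trivial trivial ?_
    unfold Bad
    omega
  intro u v hu hv hvn
  by_contra hle
  have h2 := hne u v (by omega)
  have h3 : pos π 0 ≤ pos π u := by
    rcases Nat.eq_zero_or_pos u with rfl | hu0
    · exact le_rfl
    · exact (hinc 0 u hu0 hu).le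
  have h4 : v ≠ S := by rintro rfl; omega
  rcases lt_trichotomy v T with hvT | rfl | hvT
  · -- the pattern `4213`
    refine hnb u S v T hu (by omega) hvT hTn trivial trivial trivial trivial ?_
    unfold Bad
    omega
  · omega
  · -- the pattern `3214`
    refine hnb u S T v hu hST hvT hvn trivial trivial trivial trivial ?_
    unfold Bad
    omega

/-- An evil-avoiding permutation with least recoil `T - 1` and first entry `T` is twisted if `T + 1`
comes after `T - 1`. -/
lemma isTwisted_of_lt {n T : ℕ} {π : Perm (Fin n)} (hπ : (⟨n, π⟩ : SizedPerm) ∈ Evil)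
    (hTn : T + 1 < n) (h0 : pos π T = 0) (hdrop : IsLeastDrop (pos π) T)
    (hlt : pos π (T - 1) < pos π (T + 1)) : IsTwisted π T T := by
  have hnb := mem_evil_iff.1 hπ
  simp only at hnb
  obtain ⟨h1, hinc, hd⟩ := hdrop
  refine ⟨h0, h1, le_rfl, hTn, fun u hu => ?_, fun v hv hv' => by omega⟩
  -- A value `v > T` before some `u < T` would form the pattern `2413` with `T`, `u` and `T + 1`.
  have hlt' : ∀ v, T < v → v < n → pos π u < pos π v := by
    intro v hv hvn
    by_contra hle
    have h2 := pos_ne π (show u ≠ v by omega)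
    have h3 := pos_ne π (show v ≠ T by omega)
    have h4 : pos π u < pos π (T + 1) := by
      rcases eq_or_ne u (T - 1) with rfl | huT
      · exact hlt
      · exact (hinc u (T - 1) (by omega) (by omega)).trans hlt
    have h5 : v ≠ T + 1 := by rintro rfl; omega
    refine hnb u T (T + 1) v hu (by omega) (by omega) hvn trivial trivial trivial trivial ?_
    unfold Bad
    omega
  rw [pos_eq_card π (by omega)]
  have : (Finset.range n).filter (fun v => pos π v < pos π u) = insert T (Finset.range u) := by
    ext v
    simp only [Finset.mem_filter, Finset.mem_range, Finset.mem_insert]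
    constructor
    · rintro ⟨hv, hvu⟩
      by_contra h
      rcases lt_or_ge v T with hvT | hvT
      · rcases eq_or_ne u v with rfl | huv
        · omega
        · have := hinc u v (by omega) hvT
          omega
      · have := hlt' v (by omega) hv
        omega
    · rintro (rfl | h)
      · have := pos_ne π (show u ≠ v by omega)
        exact ⟨by omega, by omega⟩
      · exact ⟨by omega, hinc v u h hu⟩
  rw [this, Finset.card_insert_of_notMem (by simp only [Finset.mem_range]; omega),
    Finset.card_range]

/-- The inverse of `ψ_q`: undo the shift if the permutation is twisted, and then delete the first
entry. -/
lemma exists_psiQ {n : ℕ} {π : Perm (Fin (n + 1))} (hπ : (⟨n + 1, π⟩ : SizedPerm) ∈ Evil)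
    (hs : ¬ HasIdSuffix π) (h0 : pos π 0 ≠ 0) :
    ∃ σ : Perm (Fin n), (recoils σ).Nonempty ∧ psiQ σ = π := by
  obtain ⟨T, hTn, hT0⟩ := exists_pos_eq π (Nat.succ_pos n)
  have hT1 : 1 ≤ T := Nat.one_le_iff_ne_zero.2 (by rintro rfl; exact h0 hT0)
  have hdrop := isLeastDrop_of_pos_eq_zero hπ hs hT1 hTn hT0
  have hTn' : T + 1 < n + 1 := by
    by_contra hlt
    refine hs (hasIdSuffix_of_order hT1 hTn.le (fun u v hu hv hvn => ?_) hdrop.2.1)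
    obtain rfl : v = T := by omega
    have := pos_ne π (show u ≠ v by omega)
    omega
  by_cases htw : ∃ a, IsTwisted π T a
  · obtain ⟨a, htw⟩ := htw
    obtain ⟨σ, T', c, d, hT', hc, hd, hsw, heq⟩ := htw.exists_sandwiched
    have ha := htw.2.1
    have haT := htw.2.2.1
    have hdrop' := hsw.isLeastDrop (by omega)
    refine ⟨σ, hdrop'.recoils_nonempty, ?_⟩
    rw [psiQ_of_sandwiched hdrop' hsw, ← heq]
    congr 1
    · exact Fin.ext hc.symm
    · exact Fin.ext (by simp only; omega)
    · congr 1
      exact Fin.ext (by simp only; omega)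
  · let T' : Fin (n + 1) := ⟨T, hTn⟩
    have hT' : (T' : ℕ) = T := rfl
    obtain ⟨σ, heq⟩ := exists_insertion π (i := T') ((pos_eq_iff π 0 T').1 hT0)
    have hlow : ∀ v < T, pos π v = pos σ v + 1 := fun v hv => by
      rw [← heq, pos_insertion_zero, if_neg (by omega), if_pos (by omega)]
    have hup : pos π (T + 1) = pos σ T + 1 := by
      rw [← heq, pos_insertion_zero, if_neg (by omega), if_neg (by omega), Nat.add_sub_cancel]
    have hlt : pos π (T + 1) < pos π (T - 1) := by
      by_contra hle
      have := pos_ne π (show T - 1 ≠ T + 1 by omega)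
      exact htw ⟨T, isTwisted_of_lt hπ hTn' hT0 hdrop (by omega)⟩
    have hdrop' : IsLeastDrop (pos σ) T := by
      refine ⟨hT1, fun u v huv hv => ?_, ?_⟩
      · have := hdrop.2.1 u v huv hv
        rw [hlow u (by omega), hlow v hv] at this
        omega
      · rw [hup, hlow _ (by omega)] at hlt
        omega
    refine ⟨σ, hdrop'.recoils_nonempty, ?_⟩
    rw [psiQ_of_not_sandwiched hdrop' ?_]
    · exact heq
    · rintro ⟨a, b, hsw⟩
      have hab := hsw.add_eq hdrop'
      obtain ⟨hb, -, hp, -⟩ := isSandwiched_iff.1 hsw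
      have hend : ∀ v < T, a ≤ v → pos π v = n + 1 - T + v := fun v hv hav => by
        rw [hlow v hv, hsw.pos_of_ge hav (by omega)]
        omega
      rcases Nat.eq_zero_or_pos a with rfl | ha
      · exact hs (hasIdSuffix_iff.2 ⟨T, hT1, hTn.le, fun c hc => hend c hc (Nat.zero_le c)⟩)
      · exact htw ⟨a, hT0, ha, by omega, hTn', fun v hv => by rw [hlow v (by omega), hp v hv], hend⟩

/-! ### Unique factorization -/

lemma eq_idPerm_zero {π : SizedPerm} (h : π.1 = 0) : π = idPerm 0 :=
  sizedPerm_ext_of_pos h fun v hv => absurd hv (by omega)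

lemma idPerm_one : idPerm 1 = psi .s (idPerm 0) :=
  sizedPerm_ext_of_pos rfl fun v hv => by
    obtain rfl : v = 0 := by simpa [idPerm] using hv
    have h1 := pos_lt (idPerm 1).2 (v := 0) Nat.one_pos
    have h2 := pos_lt (psi .s (idPerm 0)).2 (v := 0) Nat.one_pos
    have e1 : (idPerm 1).1 = 1 := rfl
    have e2 : (psi .s (idPerm 0)).1 = 1 := rfl
    omega

lemma fst_psi (x : Letter) (π : SizedPerm) : (psi x π).1 = π.1 + 1 := by cases x <;> rfl

lemma mem_evil_of_mem_psiDomain {x : Letter} {π : SizedPerm} (h : π ∈ psiDomain x) : π ∈ Evil := by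
  cases x <;> exact h.1

lemma mapsTo_psi (x : Letter) : Set.MapsTo (psi x) (psiDomain x) Evil := by
  intro π h
  have hπ := mem_evil_of_mem_psiDomain h
  cases x with
  | p => exact psiP_mem_evil_iff.2 hπ
  | q => exact (psiQ_mem_evil_iff h.2).2 hπ
  | r => exact psiR_mem_evil_iff.2 hπ
  | s =>
    rcases h.2 with rfl | hs
    · rw [← idPerm_one]; exact idPerm_mem_evil 1
    · exact (psiS_mem_evil_iff hs).2 hπ

lemma numRecoils_psiP (π : SizedPerm) : numRecoils (psi .p π) = numRecoils π := by
  rw [numRecoils_eq_ncard, numRecoils_eq_ncard, psi, recoilSet_psiP,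
    Set.ncard_image_of_injective _ Nat.succ_injective]

lemma numRecoils_psiQ {π : SizedPerm} (h : π ∈ psiDomain .q) :
    numRecoils (psi .q π) = numRecoils π := by
  rw [numRecoils_eq_ncard, numRecoils_eq_ncard]
  exact ncard_recoilSet_psiQ h.2

lemma numRecoils_psiS {π : SizedPerm} (h : π ∈ psiDomain .s) :
    numRecoils (psi .s π) = numRecoils π := by
  rcases h.2 with rfl | hs
  · rw [← idPerm_one, numRecoils_idPerm, numRecoils_idPerm]
  · rw [numRecoils_eq_ncard, numRecoils_eq_ncard, psi, recoilSet_psiS hs,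
      Set.ncard_image_of_injective _ Nat.succ_injective]

lemma numRecoils_psiR {π : SizedPerm} (h : π ∈ psiDomain .r) :
    numRecoils (psi .r π) = numRecoils π + 1 := by
  have h0 : 0 ∉ Nat.succ '' recoilSet π.2 := by
    rintro ⟨u, -, hu⟩
    exact Nat.succ_ne_zero u hu
  rw [numRecoils_eq_ncard, numRecoils_eq_ncard, psi, recoilSet_psiR h.2,
    Set.ncard_insert_of_notMem h0 ((recoilSet_finite _).image _),
    Set.ncard_image_of_injective _ Nat.succ_injective]

/-- The features of a permutation of positive size that tell which operator produced it. -/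
def IsOutput : Letter → SizedPerm → Prop
  | .p, π => ¬ HasIdSuffix π.2 ∧ pos π.2 0 = 0
  | .q, π => ¬ HasIdSuffix π.2 ∧ pos π.2 0 ≠ 0
  | .r, π => HasIdSuffix π.2 ∧ 2 ≤ π.1 ∧ pos π.2 0 + 1 = π.1
  | .s, π => HasIdSuffix π.2 ∧ (π.1 = 1 ∨ pos π.2 0 + 1 < π.1)

lemma isOutput_unique {x y : Letter} {π : SizedPerm} (hx : IsOutput x π) (hy : IsOutput y π) :
    x = y := by
  cases x <;> cases y <;> simp only [IsOutput] at hx hy <;> first | rfl | omega | tauto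

lemma exists_isOutput {π : SizedPerm} (h : 1 ≤ π.1) : ∃ x, IsOutput x π := by
  by_cases hs : HasIdSuffix π.2
  · have := pos_lt π.2 (v := 0) h
    rcases eq_or_ne π.1 1 with h1 | h1
    · exact ⟨.s, hs, Or.inl h1⟩
    · rcases eq_or_ne (pos π.2 0 + 1) π.1 with h2 | h2
      · exact ⟨.r, hs, by omega, h2⟩
      · exact ⟨.s, hs, Or.inr (by omega)⟩
  · rcases eq_or_ne (pos π.2 0) 0 with h2 | h2
    · exact ⟨.p, hs, h2⟩
    · exact ⟨.q, hs, h2⟩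

lemma not_hasIdSuffix_psiP {n : ℕ} {π : Perm (Fin n)} (h : (recoils π).Nonempty) :
    ¬ HasIdSuffix (psiP π) := by
  intro hs
  obtain ⟨t, ht, htn, hsuf⟩ := hasIdSuffix_iff.1 hs
  have h0 := hsuf 0 ht
  rw [pos_psiP, if_pos rfl] at h0
  obtain ⟨v, hv⟩ := recoils_nonempty_iff.1 h
  have hvn := recoil_lt hv
  have h1 := hsuf (v + 1) (by omega)
  have h2 := hsuf (v + 2) (by omega)
  rw [pos_psiP, if_neg (by omega)] at h1 h2
  simp only [Nat.add_sub_cancel, show v + 2 - 1 = v + 1 by omega] at h1 h2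
  omega

lemma isOutput_psi {x : Letter} {π : SizedPerm} (h : π ∈ psiDomain x) : IsOutput x (psi x π) := by
  cases x with
  | p => exact ⟨not_hasIdSuffix_psiP h.2, by rw [psi, pos_psiP, if_pos rfl]⟩
  | q => exact ⟨not_hasIdSuffix_psiQ h.2, pos_psiQ_zero_ne h.2⟩
  | r =>
    refine ⟨hasIdSuffix_psiR _, Nat.succ_le_succ h.2, ?_⟩
    rw [psi, pos_psiR _ (Nat.zero_le _), if_pos rfl]
  | s =>
    rcases h.2 with rfl | hs
    · rw [← idPerm_one]; exact ⟨hasIdSuffix_idPerm le_rfl, Or.inl rfl⟩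
    · exact ⟨hasIdSuffix_psiS hs, Or.inr (Nat.succ_lt_succ (pos_psiS_zero_lt hs))⟩

lemma psi_injOn (x : Letter) : Set.InjOn (psi x) (psiDomain x) := by
  rintro ⟨n, π⟩ hπ ⟨m, σ⟩ hσ h
  obtain rfl : n = m := by
    have := congrArg Sigma.fst h
    rw [fst_psi, fst_psi] at this
    exact Nat.succ_injective this
  congr 1
  cases x with
  | p => exact insertion_zero_injective 0 (by simpa [psi, psiP] using h)
  | q => exact psiQ_injective hπ.2 hσ.2 (by simpa [psi] using h)
  | r => exact insertion_last_injective 0 (by simpa [psi, psiR] using h)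
  | s =>
    rcases Nat.eq_zero_or_pos n with rfl | hn
    · exact Subsingleton.elim _ _
    · have key : ∀ τ : Perm (Fin n), (⟨n, τ⟩ : SizedPerm) ∈ psiDomain .s → HasIdSuffix τ := by
        rintro τ ⟨-, hτ | hτ⟩
        · have := congrArg Sigma.fst hτ
          simp only [idPerm] at this
          omega
        · exact hτ
      exact psiS_injective (key π hπ) (key σ hσ) (by simpa [psi] using h)

lemma exists_psi {x : Letter} {π : SizedPerm} (hπ : π ∈ Evil) (h1 : 1 ≤ π.1)
    (hx : IsOutput x π) : ∃ σ ∈ psiDomain x, psi x σ = π := by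
  obtain ⟨n, π⟩ := π
  obtain ⟨n, rfl⟩ : ∃ m, n = m + 1 := ⟨n - 1, by simp only at h1; omega⟩
  cases x with
  | p =>
    obtain ⟨σ, rfl⟩ := exists_psiP hx.2
    refine ⟨⟨n, σ⟩, ⟨psiP_mem_evil_iff.1 hπ, ?_⟩, rfl⟩
    -- without a recoil `ψ_p(σ)` would be the identity, which is an identity suffix of itself
    by_contra hr
    refine hx.1 (hasIdSuffix_iff.2 ⟨n + 1, by omega, le_rfl, fun c _ => ?_⟩)
    simp only [pos_psiP, pos_eq_self_of_recoils hr]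
    split_ifs <;> omega
  | q =>
    obtain ⟨σ, hr, rfl⟩ := exists_psiQ hπ hx.1 hx.2
    exact ⟨⟨n, σ⟩, ⟨(psiQ_mem_evil_iff hr).1 hπ, hr⟩, rfl⟩
  | r =>
    obtain ⟨σ, rfl⟩ := exists_psiR (Nat.succ_injective hx.2.2)
    exact ⟨⟨n, σ⟩, ⟨psiR_mem_evil_iff.1 hπ, Nat.succ_le_succ_iff.1 hx.2.1⟩, rfl⟩
  | s =>
    rcases Nat.eq_zero_or_pos n with rfl | hn
    · refine ⟨idPerm 0, ⟨idPerm_mem_evil 0, Or.inl rfl⟩, ?_⟩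
      rw [← idPerm_one]
      refine (eq_idPerm_of_recoils (π := ⟨0 + 1, π⟩) fun hr => ?_).symm
      obtain ⟨v, hv⟩ := recoils_nonempty_iff.1 hr
      have := recoil_lt hv
      simp only at this
      omega
    · have hx2 : n + 1 = 1 ∨ pos π 0 + 1 < n + 1 := hx.2
      have hlt : pos π 0 < n := by omega
      obtain ⟨σ, hs, rfl⟩ := exists_psiS hx.1 hlt
      exact ⟨⟨n, σ⟩, ⟨(psiS_mem_evil_iff hs).1 hπ, Or.inr hs⟩, rfl⟩

lemma eval_mem_evil : ∀ {w : List Letter}, IsValid w → eval w ∈ Evil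
  | [], _ => idPerm_mem_evil 0
  | x :: _, h => mapsTo_psi x h.2

lemma fst_eval (w : List Letter) : (eval w).1 = w.length := by
  induction w with
  | nil => rfl
  | cons x w ih => rw [eval, fst_psi, ih, List.length_cons]

lemma exists_word {π : SizedPerm} (h : π ∈ Evil) : ∃ w, IsValid w ∧ eval w = π := by
  induction hn : π.1 generalizing π with
  | zero => exact ⟨[], trivial, (eq_idPerm_zero hn).symm⟩
  | succ n ih =>
    obtain ⟨x, hx⟩ := exists_isOutput (π := π) (by omega)
    obtain ⟨σ, hσ, rfl⟩ := exists_psi h (by omega) hx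
    rw [fst_psi] at hn
    obtain ⟨w, hw, rfl⟩ := ih (mem_evil_of_mem_psiDomain hσ) (by omega)
    exact ⟨x :: w, ⟨hw, hσ⟩, rfl⟩

lemma eval_injOn {w w' : List Letter} (hw : IsValid w) (hw' : IsValid w')
    (h : eval w = eval w') : w = w' := by
  induction w generalizing w' with
  | nil =>
    have := congrArg Sigma.fst h
    rw [fst_eval, fst_eval] at this
    exact (List.eq_nil_of_length_eq_zero this.symm).symm
  | cons x w ih =>
    cases w' with
    | nil =>
      have := congrArg Sigma.fst h
      rw [fst_eval, fst_eval] at this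
      exact List.eq_nil_of_length_eq_zero this
    | cons y w' =>
      have hy := isOutput_psi hw'.2
      obtain rfl : x = y := isOutput_unique (isOutput_psi hw.2) (by
        change eval (x :: w) = psi y (eval w') at h
        rw [← h] at hy
        exact hy)
      rw [ih hw.1 hw'.1 (psi_injOn x hw.2 hw'.2 h)]

lemma numRecoils_eval {w : List Letter} (h : IsValid w) :
    numRecoils (eval w) = w.count .r := by
  induction w with
  | nil => exact numRecoils_idPerm 0
  | cons x w ih =>
    cases x with
    | p => rw [eval, numRecoils_psiP, ih h.1, List.count_cons_of_ne (by decide)]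
    | q => rw [eval, numRecoils_psiQ h.2, ih h.1, List.count_cons_of_ne (by decide)]
    | r => rw [eval, numRecoils_psiR h.2, ih h.1, List.count_cons_self]
    | s => rw [eval, numRecoils_psiS h.2, ih h.1, List.count_cons_of_ne (by decide)]

/-! ### The language of valid words -/

/-- The condition on a valid word `w` for `x :: w` to be valid, in terms of the letters of `w`. -/
def CanPrepend : Letter → List Letter → Prop
  | .p, w => Letter.r ∈ w
  | .q, w => Letter.r ∈ w
  | .r, w => w ≠ []
  | .s, w => w.head? ≠ some .p ∧ w.head? ≠ some .q

lemma recoils_eval_nonempty_iff {w : List Letter} (h : IsValid w) :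
    (recoils (eval w).2).Nonempty ↔ Letter.r ∈ w := by
  rw [recoils_nonempty_iff_numRecoils, numRecoils_eval h, Ne, List.count_eq_zero, not_not]

lemma hasIdSuffix_eval_cons_iff {x : Letter} {w : List Letter} (h : IsValid (x :: w)) :
    HasIdSuffix (eval (x :: w)).2 ↔ x ≠ .p ∧ x ≠ .q := by
  have hx := isOutput_psi h.2
  change IsOutput x (eval (x :: w)) at hx
  cases x
  · simpa using hx.1
  · simpa using hx.1
  · simpa using hx.1
  · simpa using hx.1

lemma isValid_cons_iff {x : Letter} {w : List Letter} :
    IsValid (x :: w) ↔ IsValid w ∧ CanPrepend x w := by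
  refine and_congr_right fun hw => ?_
  have he := eval_mem_evil hw
  cases x with
  | p => exact (and_iff_right he).trans (recoils_eval_nonempty_iff hw)
  | q => exact (and_iff_right he).trans (recoils_eval_nonempty_iff hw)
  | r =>
    refine (and_iff_right he).trans ?_
    rw [fst_eval]
    exact List.length_pos_iff
  | s =>
    refine (and_iff_right he).trans ?_
    cases w with
    | nil => simp [CanPrepend, eval]
    | cons y w =>
      rw [hasIdSuffix_eval_cons_iff hw, or_iff_right]
      · simp [CanPrepend]
      · intro h
        have := congrArg Sigma.fst h
        rw [fst_eval] at this
        simp [idPerm] at this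

/-- Neither `p` nor `q` is immediately before the terminal string of letters `s` of `w`. -/
def TailCond (w : List Letter) : Prop :=
  ∀ (u : List Letter) (m : ℕ), w ≠ u ++ Letter.p :: List.replicate m Letter.s ∧
    w ≠ u ++ Letter.q :: List.replicate m Letter.s

lemma tailCond_cons_iff {x : Letter} {w : List Letter} :
    TailCond (x :: w) ↔
      TailCond w ∧ ((x = .p ∨ x = .q) → ∀ m, w ≠ List.replicate m Letter.s) := by
  constructor
  · refine fun h => ⟨fun u m => ⟨fun hw => (h (x :: u) m).1 (by rw [hw]; rfl),
      fun hw => (h (x :: u) m).2 (by rw [hw]; rfl)⟩, ?_⟩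
    rintro (rfl | rfl) m rfl
    · exact (h [] m).1 rfl
    · exact (h [] m).2 rfl
  · rintro ⟨h, hx⟩ u m
    cases u with
    | nil =>
      constructor
      · intro hw
        obtain ⟨rfl, rfl⟩ := List.cons.inj hw
        exact hx (Or.inl rfl) m rfl
      · intro hw
        obtain ⟨rfl, rfl⟩ := List.cons.inj hw
        exact hx (Or.inr rfl) m rfl
    | cons y u =>
      exact ⟨fun hw => (h u m).1 (List.cons.inj hw).2, fun hw => (h u m).2 (List.cons.inj hw).2⟩

lemma TailCond.mem_iff {w : List Letter} (h : TailCond w) :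
    Letter.r ∈ w ↔ ∀ m, w ≠ List.replicate m Letter.s := by
  constructor
  · rintro hr m rfl
    exact absurd (List.eq_of_mem_replicate hr) (by decide)
  · intro hw
    by_contra hr
    apply (not_exists.2 hw)
    clear hw
    induction w with
    | nil => exact ⟨0, rfl⟩
    | cons x w ih =>
      obtain ⟨h, hx⟩ := tailCond_cons_iff.1 h
      obtain ⟨hxr, hr⟩ := not_or.1 (mt List.mem_cons.2 hr)
      obtain ⟨m, hm⟩ := ih h hr
      cases x with
      | p => exact absurd hm (hx (Or.inl rfl) m)
      | q => exact absurd hm (hx (Or.inr rfl) m)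
      | r => exact absurd rfl hxr
      | s => exact ⟨m + 1, by rw [hm]; rfl⟩

lemma pair_infix_cons_iff {x y a : Letter} {w : List Letter} :
    [x, y] <:+: a :: w ↔ (a = x ∧ w.head? = some y) ∨ [x, y] <:+: w := by
  rw [List.infix_cons_iff, List.cons_prefix_cons]
  refine or_congr_left (and_congr eq_comm ?_)
  cases w with
  | nil => simp
  | cons b w => simp [List.cons_prefix_cons, eq_comm]

lemma isValid_iff {w : List Letter} (hw : w ≠ []) :
    IsValid w ↔ w.getLast? = some Letter.s ∧ ¬ [Letter.s, Letter.p] <:+: w ∧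
      ¬ [Letter.s, Letter.q] <:+: w ∧ TailCond w := by
  induction w with
  | nil => exact absurd rfl hw
  | cons x w ih =>
    rw [isValid_cons_iff, pair_infix_cons_iff, pair_infix_cons_iff, tailCond_cons_iff]
    cases w with
    | nil =>
      have h0 : TailCond [] := fun u m => ⟨by simp, by simp⟩
      cases x with
      | p => simp [CanPrepend]
      | q => simp [CanPrepend]
      | r => simp [CanPrepend]
      | s => simp [CanPrepend, IsValid, h0]
    | cons y w =>
      rw [ih (by simp), List.getLast?_cons_cons]
      set v := y :: w with hv
      have hv0 : v ≠ [] := by simp [hv]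
      by_cases ht : TailCond v
      · have hr := ht.mem_iff
        cases x with
        | p => simp only [CanPrepend, hr]; simp; tauto
        | q => simp only [CanPrepend, hr]; simp; tauto
        | r => simp only [CanPrepend]; simp [hv0]
        | s => simp only [CanPrepend]; simp; tauto
      · simp only [ht, and_false, false_and]

lemma mem_singleton_mul {x : Letter} {l : Language Letter} {w : List Letter} :
    w ∈ ({[x]} : Language Letter) * l ↔ ∃ v ∈ l, w = x :: v := by
  rw [Language.mem_mul]
  constructor
  · rintro ⟨a, rfl, b, hb, rfl⟩; exact ⟨b, hb, rfl⟩
  · rintro ⟨v, hv, rfl⟩; exact ⟨[x], rfl, v, hv, rfl⟩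

lemma singleton_mul_le_iff {x : Letter} {l l' : Language Letter} :
    ({[x]} : Language Letter) * l ≤ l' ↔ ∀ w ∈ l, x :: w ∈ l' := by
  constructor
  · exact fun h w hw => h (mem_singleton_mul.2 ⟨w, hw, rfl⟩)
  · intro h w hw
    obtain ⟨v, hv, rfl⟩ := mem_singleton_mul.1 hw
    exact h v hv

open scoped Computability in
lemma evilRegex_matches : evilRegex.matches' =
    ((({[Letter.p]} + {[Letter.q]})∗ * ({[Letter.s]})∗ * {[Letter.r]})∗ *
      ({[Letter.s]} * ({[Letter.s]})∗) : Language Letter) := by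
  simp [evilRegex]

open scoped Computability in
/-- Every word of the regular language is valid: prefixing words of `s^* r` and then of `(p|q)^*`
preserves validity. -/
lemma evilRegex_le : evilRegex.matches' ≤ LEvil := by
  rw [evilRegex_matches]
  -- `V₁` and `V₂` consist of the nonempty valid words that may be prefixed by `s` and by `p` and
  -- `q`, respectively, and `V₃` is their intersection
  let V : Language Letter := {w | w ≠ [] ∧ IsValid w}
  let V₁ : Language Letter := {w | (w ≠ [] ∧ IsValid w) ∧ CanPrepend .s w}
  let V₂ : Language Letter := {w | (w ≠ [] ∧ IsValid w) ∧ Letter.r ∈ w}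
  let V₃ : Language Letter := {w | ((w ≠ [] ∧ IsValid w) ∧ CanPrepend .s w) ∧ Letter.r ∈ w}
  have hs1 : ({[Letter.s]} : Language Letter) * V₁ ≤ V₁ := singleton_mul_le_iff.2
    fun w hw => ⟨⟨List.cons_ne_nil _ _, isValid_cons_iff.2 ⟨hw.1.2, hw.2⟩⟩, by simp [CanPrepend]⟩
  have hs3 : ({[Letter.s]} : Language Letter) * V₃ ≤ V₃ := singleton_mul_le_iff.2
    fun w hw => ⟨⟨⟨List.cons_ne_nil _ _, isValid_cons_iff.2 ⟨hw.1.1.2, hw.1.2⟩⟩,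
      by simp [CanPrepend]⟩, List.mem_cons_of_mem _ hw.2⟩
  have hr : ({[Letter.r]} : Language Letter) * V ≤ V₃ := singleton_mul_le_iff.2
    fun w hw => ⟨⟨⟨List.cons_ne_nil _ _, isValid_cons_iff.2 ⟨hw.2, hw.1⟩⟩,
      by simp [CanPrepend]⟩, List.mem_cons_self⟩
  have hpq : ({[Letter.p]} + {[Letter.q]} : Language Letter) * V₂ ≤ V₂ := by
    rw [add_mul]
    refine add_le (singleton_mul_le_iff.2 fun w hw => ?_) (singleton_mul_le_iff.2 fun w hw => ?_)
    · exact ⟨⟨List.cons_ne_nil _ _, isValid_cons_iff.2 ⟨hw.1.2, hw.2⟩⟩,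
        List.mem_cons_of_mem _ hw.2⟩
    · exact ⟨⟨List.cons_ne_nil _ _, isValid_cons_iff.2 ⟨hw.1.2, hw.2⟩⟩,
        List.mem_cons_of_mem _ hw.2⟩
  have hss : ({[Letter.s]} * ({[Letter.s]})∗ : Language Letter) ≤ V := by
    have h1 : ({[Letter.s]} : Language Letter) ≤ V₁ := by
      rintro w rfl
      exact ⟨⟨List.cons_ne_nil _ _, isValid_cons_iff.2 ⟨trivial, by simp [CanPrepend]⟩⟩,
        by simp [CanPrepend]⟩
    have h2 : (({[Letter.s]})∗ * {[Letter.s]} : Language Letter) ≤ V₁ :=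
      (mul_le_mul_right h1 _).trans (kstar_mul_le_self hs1)
    rw [Language.mul_self_kstar_comm] at h2
    exact h2.trans fun w hw => hw.1
  refine le_trans (mul_le_mul_right hss _) (kstar_mul_le_self ?_)
  calc (({[Letter.p]} + {[Letter.q]})∗ * ({[Letter.s]})∗ * {[Letter.r]} * V : Language Letter)
      = ({[Letter.p]} + {[Letter.q]})∗ * (({[Letter.s]})∗ * ({[Letter.r]} * V)) := by
        simp only [mul_assoc]
    _ ≤ ({[Letter.p]} + {[Letter.q]})∗ * (({[Letter.s]})∗ * V₃) := by gcongr
    _ ≤ ({[Letter.p]} + {[Letter.q]})∗ * V₃ := by gcongr; exact kstar_mul_le_self hs3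
    _ ≤ ({[Letter.p]} + {[Letter.q]})∗ * V₂ := by gcongr; exact fun w hw => ⟨hw.1.1, hw.2⟩
    _ ≤ V₂ := kstar_mul_le_self hpq
    _ ≤ V := fun w hw => hw.1

open scoped Computability in
/-- By induction from the right: a valid word that contains `r` lies in `(p|q)^* s^* r L`, and
even in `s^* r L` if it begins with `r` or `s`, where `L` is the regular language. -/
lemma le_evilRegex : LEvil ≤ evilRegex.matches' := by
  rw [evilRegex_matches]
  set P : Language Letter := {[Letter.p]} + {[Letter.q]} with hP
  set S : Language Letter := {[Letter.s]} with hS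
  set R : Language Letter := {[Letter.r]} with hR
  set L : Language Letter := (P∗ * S∗ * R)∗ * (S * S∗) with hL
  have hAL : P∗ * S∗ * R * L ≤ L := by
    rw [hL, ← mul_assoc]
    gcongr
    exact mul_kstar_le_kstar
  have hSRL : S∗ * (R * L) ≤ P∗ * S∗ * R * L := by
    have : (1 : Language Letter) * (S∗ * (R * L)) ≤ P∗ * (S∗ * (R * L)) := by
      gcongr; exact one_le_kstar
    simpa only [one_mul, mul_assoc] using this
  have hRL : R * L ≤ S∗ * (R * L) := by
    have : (1 : Language Letter) * (R * L) ≤ S∗ * (R * L) := by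
      gcongr; exact one_le_kstar
    simpa only [one_mul] using this
  have hSL : S * S∗ ≤ L := by
    have : (1 : Language Letter) * (S * S∗) ≤ L := by
      rw [hL]; gcongr; exact one_le_kstar
    simpa only [one_mul] using this
  have hPAL : P * (P∗ * S∗ * R * L) ≤ P∗ * S∗ * R * L := by
    simp only [mul_assoc]
    rw [← mul_assoc]
    gcongr
    exact mul_kstar_le_kstar
  have hSSRL : S * (S∗ * (R * L)) ≤ S∗ * (R * L) := by
    rw [← mul_assoc]
    gcongr
    exact mul_kstar_le_kstar
  have hSSS : S * (S * S∗) ≤ S * S∗ := by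
    gcongr
    exact mul_kstar_le_kstar
  have hS1 : S ≤ S * S∗ := by
    have : S * 1 ≤ S * S∗ := by gcongr; exact one_le_kstar
    simpa only [mul_one] using this
  have cons : ∀ {x : Letter} {l : Language Letter} {w : List Letter}, w ∈ l →
      x :: w ∈ ({[x]} : Language Letter) * l := fun h => mem_singleton_mul.2 ⟨_, h, rfl⟩
  have key : ∀ w : List Letter, w ≠ [] → IsValid w →
      w ∈ L ∧ (Letter.r ∉ w → w ∈ S * S∗) ∧ (Letter.r ∈ w → w ∈ P∗ * S∗ * R * L ∧
        (CanPrepend .s w → w ∈ S∗ * (R * L))) := by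
    intro w
    induction w with
    | nil => exact fun h => absurd rfl h
    | cons x w ih =>
      intro _ hx
      obtain ⟨hw, hc⟩ := isValid_cons_iff.1 hx
      cases x with
      | p =>
        obtain ⟨-, -, h⟩ := ih (List.ne_nil_of_mem hc) hw
        have h1 : Letter.p :: w ∈ P * (P∗ * S∗ * R * L) := by
          rw [hP, add_mul]
          exact Or.inl (cons (h hc).1)
        have h2 := hPAL h1
        exact ⟨hAL h2, fun hr => absurd (List.mem_cons_of_mem _ hc) hr,
          fun _ => ⟨h2, fun h => absurd rfl h.1⟩⟩
      | q =>
        obtain ⟨-, -, h⟩ := ih (List.ne_nil_of_mem hc) hw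
        have h1 : Letter.q :: w ∈ P * (P∗ * S∗ * R * L) := by
          rw [hP, add_mul]
          exact Or.inr (cons (h hc).1)
        have h2 := hPAL h1
        exact ⟨hAL h2, fun hr => absurd (List.mem_cons_of_mem _ hc) hr,
          fun _ => ⟨h2, fun h => absurd rfl h.2⟩⟩
      | r =>
        have h1 := hRL (cons (ih hc hw).1)
        have h2 := hSRL h1
        exact ⟨hAL h2, fun hr => absurd List.mem_cons_self hr, fun _ => ⟨h2, fun _ => h1⟩⟩
      | s =>
        by_cases hr : Letter.r ∈ w
        · obtain ⟨-, -, h⟩ := ih (List.ne_nil_of_mem hr) hw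
          have h1 := hSSRL (cons ((h hr).2 hc))
          have h2 := hSRL h1
          exact ⟨hAL h2, fun hr' => absurd (List.mem_cons_of_mem _ hr) hr',
            fun _ => ⟨h2, fun _ => h1⟩⟩
        · have h1 : Letter.s :: w ∈ S * S∗ := by
            rcases eq_or_ne w [] with rfl | h0
            · exact hS1 rfl
            · exact hSSS (cons ((ih h0 hw).2.1 hr))
          refine ⟨hSL h1, fun _ => h1, fun hr' => absurd hr' ?_⟩
          simpa using hr
  exact fun w hw => (key w hw.1 hw.2).1

/-! ### The block operators -/

lemma appendBlock_apply {m : ℕ} (π : SizedPerm) (x : Fin π.1 ⊕ Fin m) :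
    (appendBlock m π).2 (finSumFinEquiv x) = finCongr (Nat.add_comm m π.1)
      (finSumFinEquiv (sumComm _ _ (sumCongr π.2 (Equiv.refl (Fin m)) x))) := by
  change finCongr (Nat.add_comm m π.1) (finSumFinEquiv (sumComm _ _ (sumCongr π.2
    (Equiv.refl (Fin m)) (finSumFinEquiv.symm (finSumFinEquiv x))))) = _
  rw [symm_apply_apply]

lemma pos_appendBlock_of_lt {m : ℕ} (π : SizedPerm) {v : ℕ} (hv : v < m) :
    pos (appendBlock m π).2 v = π.1 + v := by
  have := pos_eq_iff (appendBlock m π).2 (finSumFinEquiv (Sum.inr ⟨v, hv⟩))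
    (finCongr (Nat.add_comm m π.1) (finSumFinEquiv (Sum.inl ⟨v, hv⟩)))
  exact this.2 (by rw [appendBlock_apply]; rfl)

lemma pos_appendBlock_add {m : ℕ} (π : SizedPerm) {v : ℕ} (hv : v < π.1) :
    pos (appendBlock m π).2 (m + v) = pos π.2 v := by
  have := pos_eq_iff (appendBlock m π).2 (finSumFinEquiv (Sum.inl (π.2.symm ⟨v, hv⟩)))
    (finCongr (Nat.add_comm m π.1) (finSumFinEquiv (Sum.inr ⟨v, hv⟩)))
  rw [pos_of_lt π.2 hv]
  exact this.2 (by
    rw [appendBlock_apply, sumCongr_apply, Sum.map_inl, apply_symm_apply]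
    rfl)

lemma hasIdSuffix_appendBlock {m : ℕ} (hm : 1 ≤ m) (π : SizedPerm) :
    HasIdSuffix (appendBlock m π).2 :=
  hasIdSuffix_iff.2 ⟨m, hm, Nat.le_add_left _ _, fun c hc => by
    rw [pos_appendBlock_of_lt π hc]; simp [appendBlock]⟩

lemma psi_r_eq_appendBlock (π : SizedPerm) : psi .r π = appendBlock 1 π := by
  refine sizedPerm_ext_of_pos rfl fun v hv => ?_
  have hv' : v ≤ π.1 := Nat.lt_succ_iff.1 hv
  rw [psi, pos_psiR _ hv']
  rcases Nat.eq_zero_or_pos v with rfl | h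
  · rw [pos_appendBlock_of_lt π Nat.one_pos]; simp
  · obtain ⟨u, rfl⟩ : ∃ u, v = 1 + u := ⟨v - 1, by omega⟩
    rw [pos_appendBlock_add π (by omega), if_neg (by omega), Nat.add_sub_cancel_left]

lemma psi_s_appendBlock {m : ℕ} (hm : 1 ≤ m) (π : SizedPerm) :
    psi .s (appendBlock m π) = appendBlock (m + 1) π := by
  refine sizedPerm_ext_of_pos rfl fun v hv => ?_
  have hv' : v ≤ π.1 + m := Nat.lt_succ_iff.1 hv
  have hfst : (appendBlock m π).1 = π.1 + m := rfl
  have hsuf : ∀ c < m, pos (appendBlock m π).2 c = (appendBlock m π).1 - m + c := fun c hc => by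
    rw [pos_appendBlock_of_lt π hc, hfst, Nat.add_sub_cancel]
  rw [psi, pos_psiS hm (by omega) hsuf (by omega)]
  rcases lt_trichotomy v m with h | rfl | h
  · rw [if_neg (by omega), if_pos h, pos_appendBlock_of_lt π h, pos_appendBlock_of_lt π (by omega)]
  · rw [if_pos rfl, pos_appendBlock_of_lt π (by omega), hfst]
  · obtain ⟨u, rfl⟩ : ∃ u, v = m + 1 + u := ⟨v - (m + 1), by omega⟩
    rw [if_neg (by omega), if_neg (by omega), pos_appendBlock_add π (by omega),
      show m + 1 + u - 1 = m + u by omega, pos_appendBlock_add π (by omega)]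

lemma iterate_psi_s {π : SizedPerm} (hπ : π ∈ psiDomain .r) (m : ℕ) :
    (psi .s)^[m] (psi .r π) ∈ psiDomain .s ∧ (psi .s)^[m] (psi .r π) = appendBlock (m + 1) π := by
  induction m with
  | zero =>
    have h : psi .r π ∈ psiDomain .s := ⟨mapsTo_psi .r hπ, Or.inr (hasIdSuffix_psiR _)⟩
    exact ⟨h, psi_r_eq_appendBlock π⟩
  | succ m ih =>
    have h := mapsTo_psi .s ih.1
    rw [Function.iterate_succ_apply', ih.2, psi_s_appendBlock (by omega)]
    rw [ih.2, psi_s_appendBlock (by omega)] at h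
    exact ⟨⟨h, Or.inr (hasIdSuffix_appendBlock (by omega) π)⟩, rfl⟩

lemma eval_replicate_append (m : ℕ) (w : List Letter) :
    eval (List.replicate m .s ++ w) = (psi .s)^[m] (eval w) := by
  induction m with
  | zero => rfl
  | succ m ih => rw [Function.iterate_succ_apply', ← ih]; rfl

lemma eval_block {w : List Letter} (hw : IsValid w) (h0 : w ≠ []) (m : ℕ) :
    IsValid (List.replicate m .s ++ .r :: w) ∧
      eval (List.replicate m .s ++ .r :: w) = appendBlock (m + 1) (eval w) := by
  have hr : eval w ∈ psiDomain .r :=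
    ⟨eval_mem_evil hw, by rw [fst_eval]; exact List.length_pos_iff.2 h0⟩
  refine ⟨?_, by rw [eval_replicate_append, ← (iterate_psi_s hr m).2]; rfl⟩
  induction m with
  | zero => exact ⟨hw, hr⟩
  | succ m ih =>
    refine ⟨ih, ?_⟩
    have h := (iterate_psi_s hr m).1
    rwa [show psi .r (eval w) = eval (.r :: w) from rfl, ← eval_replicate_append] at h

/-! ### The decomposition by size and number of recoils -/

lemma IsValid.of_append {u w : List Letter} (h : IsValid (u ++ w)) : IsValid w := by
  induction u with
  | nil => exact h
  | cons x u ih => exact ih h.1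

lemma exists_block_of_mem {w : List Letter} (h : IsValid w) (hr : Letter.r ∈ w)
    (hc : CanPrepend .s w) : ∃ m v, w = List.replicate m .s ++ .r :: v := by
  induction w with
  | nil => simp at hr
  | cons x w ih =>
    cases x with
    | p => exact absurd rfl hc.1
    | q => exact absurd rfl hc.2
    | r => exact ⟨0, w, rfl⟩
    | s =>
      obtain ⟨m, v, rfl⟩ := ih h.1 (by simpa using hr) (isValid_cons_iff.1 h).2
      exact ⟨m + 1, v, rfl⟩

lemma block_inj {m m' : ℕ} {v v' : List Letter}
    (h : List.replicate m Letter.s ++ .r :: v = List.replicate m' Letter.s ++ .r :: v') :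
    m = m' := by
  induction m generalizing m' with
  | zero => cases m' with
    | zero => rfl
    | succ m' => simp [List.replicate_succ] at h
  | succ m ih => cases m' with
    | zero => simp [List.replicate_succ] at h
    | succ m' => rw [ih (List.cons.inj h).2]

lemma count_lt_length {w : List Letter} (h : IsValid w) (h0 : w ≠ []) :
    w.count .r < w.length := by
  induction w with
  | nil => exact absurd rfl h0
  | cons x w ih =>
    rcases eq_or_ne w [] with rfl | hw
    · have := (isValid_cons_iff.1 h).2
      cases x <;> simp [CanPrepend] at this ⊢
    · have := ih h.1 hw
      have := List.count_cons (a := Letter.r) (b := x) (l := w)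
      rw [List.length_cons]
      split_ifs at this <;> omega

lemma mem_evilGraded_iff {n k : ℕ} {π : SizedPerm} :
    π ∈ EvilGraded n k ↔ ∃ w, IsValid w ∧ w.length = n ∧ w.count .r = k ∧ eval w = π := by
  constructor
  · rintro ⟨h, hn, hk⟩
    obtain ⟨w, hw, rfl⟩ := exists_word h
    exact ⟨w, hw, by rw [← hn, fst_eval], by rw [← hk, numRecoils_eval hw], rfl⟩
  · rintro ⟨w, hw, hn, hk, rfl⟩
    exact ⟨eval_mem_evil hw, by rw [fst_eval, hn], by rw [numRecoils_eval hw, hk]⟩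

lemma evilGraded_zero_right (n : ℕ) : EvilGraded n 0 = {idPerm n} := by
  ext π
  constructor
  · rintro ⟨-, rfl, hk⟩
    exact eq_idPerm_of_recoils (by rw [recoils_nonempty_iff_numRecoils, not_not]; exact hk)
  · rintro rfl
    exact ⟨idPerm_mem_evil n, rfl, numRecoils_idPerm n⟩

lemma evilGraded_zero_left {k : ℕ} (hk : 1 ≤ k) : EvilGraded 0 k = ∅ := by
  ext π
  simp only [Set.mem_empty_iff_false, iff_false]
  rintro ⟨-, h0, h⟩
  rw [eq_idPerm_zero h0, numRecoils_idPerm] at h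
  omega

/-- For `x = p` and `x = q`, the part of the decomposition that comes from `ψ_x` consists of the
permutations whose words begin with `x`. -/
lemma mem_image_psi_iff {x : Letter} (hx : x = .p ∨ x = .q) {n k : ℕ} (hk : 1 ≤ k)
    {π : SizedPerm} : π ∈ psi x '' EvilGraded n k ↔
      ∃ w, IsValid (x :: w) ∧ w.length = n ∧ w.count .r = k ∧ eval (x :: w) = π := by
  constructor
  · rintro ⟨σ, hσ, rfl⟩
    obtain ⟨w, hw, hn, hk', rfl⟩ := mem_evilGraded_iff.1 hσ
    refine ⟨w, isValid_cons_iff.2 ⟨hw, ?_⟩, hn, hk', rfl⟩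
    have hr : Letter.r ∈ w := List.count_pos_iff.1 (by omega)
    rcases hx with rfl | rfl <;> exact hr
  · rintro ⟨w, hw, hn, hk', rfl⟩
    exact ⟨eval w, mem_evilGraded_iff.2 ⟨w, hw.1, hn, hk', rfl⟩, rfl⟩

/-- The parts of the decomposition that come from block operators consist of the permutations whose
words begin with a given number of letters `s` followed by `r`. -/
lemma mem_image_appendBlock_iff {n k j : ℕ} (hk : 1 ≤ k) (hj : j ∈ Set.Icc k n)
    {π : SizedPerm} : π ∈ appendBlock (n + 1 - j) '' EvilGraded j (k - 1) ↔
      ∃ w, IsValid (List.replicate (n - j) .s ++ .r :: w) ∧ w.length = j ∧ w.count .r = k - 1 ∧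
        eval (List.replicate (n - j) .s ++ .r :: w) = π := by
  obtain ⟨hkj, hjn⟩ := hj
  have e : n + 1 - j = n - j + 1 := by omega
  rw [e]
  constructor
  · rintro ⟨σ, hσ, rfl⟩
    obtain ⟨w, hw, hn, hk', rfl⟩ := mem_evilGraded_iff.1 hσ
    obtain ⟨h1, h2⟩ := eval_block hw (List.length_pos_iff.1 (by omega)) (n - j)
    exact ⟨w, h1, hn, hk', h2⟩
  · rintro ⟨w, hw, hn, hk', rfl⟩
    have hw' : IsValid w := hw.of_append.1
    exact ⟨eval w, mem_evilGraded_iff.2 ⟨w, hw', hn, hk', rfl⟩,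
      (eval_block hw' (List.length_pos_iff.1 (by omega)) (n - j)).2.symm⟩

lemma evilGraded_succ (n : ℕ) {k : ℕ} (hk : 1 ≤ k) :
    EvilGraded (n + 1) k = psi .p '' EvilGraded n k ∪ psi .q '' EvilGraded n k ∪
      ⋃ j ∈ Set.Icc k n, appendBlock (n + 1 - j) '' EvilGraded j (k - 1) := by
  ext π
  rw [mem_evilGraded_iff, Set.mem_union, Set.mem_union, mem_image_psi_iff (Or.inl rfl) hk,
    mem_image_psi_iff (Or.inr rfl) hk]
  simp only [Set.mem_iUnion]
  constructor
  · rintro ⟨w, hw, hn, hk', rfl⟩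
    by_cases hc : CanPrepend .s w
    · obtain ⟨m, v, rfl⟩ := exists_block_of_mem hw (List.count_pos_iff.1 (by omega)) hc
      have hv : IsValid (.r :: v) := hw.of_append
      have hlt := count_lt_length hv.1 (isValid_cons_iff.1 hv).2
      simp only [List.length_append, List.length_replicate, List.length_cons] at hn
      rw [List.count_append, List.count_replicate, List.count_cons_self] at hk'
      simp only [show (Letter.s == Letter.r) = false by decide] at hk'
      have hj : v.length ∈ Set.Icc k n := ⟨by simp at hk'; omega, by omega⟩
      refine Or.inr ⟨v.length, hj, (mem_image_appendBlock_iff hk hj).2 ?_⟩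
      obtain rfl : m = n - v.length := by omega
      exact ⟨v, hw, rfl, by simp at hk'; omega, rfl⟩
    · cases w with
      | nil => simp at hn
      | cons x w =>
        cases x with
        | p => exact Or.inl (Or.inl ⟨w, hw, by simpa using hn, by simpa using hk', rfl⟩)
        | q => exact Or.inl (Or.inr ⟨w, hw, by simpa using hn, by simpa using hk', rfl⟩)
        | r => simp [CanPrepend] at hc
        | s => simp [CanPrepend] at hc
  · rintro ((⟨w, hw, hn, hk', rfl⟩ | ⟨w, hw, hn, hk', rfl⟩) | ⟨j, hj, h⟩)
    · exact ⟨_, hw, by simp [hn], by simp [hk'], rfl⟩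
    · exact ⟨_, hw, by simp [hn], by simp [hk'], rfl⟩
    · obtain ⟨w, hw, hn, hk', rfl⟩ := (mem_image_appendBlock_iff hk hj).1 h
      obtain ⟨h1, h2⟩ := hj
      refine ⟨_, hw, by simp [hn]; omega, ?_, rfl⟩
      rw [List.count_append, List.count_replicate, List.count_cons_self, hk']
      simp only [show (Letter.s == Letter.r) = false by decide]
      simp; omega

lemma disjoint_psi_p_psi_q (n : ℕ) {k : ℕ} (hk : 1 ≤ k) :
    Disjoint (psi .p '' EvilGraded n k) (psi .q '' EvilGraded n k) := by
  rw [Set.disjoint_left]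
  intro π hp hq
  obtain ⟨w, hw, -, -, h⟩ := (mem_image_psi_iff (Or.inl rfl) hk).1 hp
  obtain ⟨w', hw', -, -, h'⟩ := (mem_image_psi_iff (Or.inr rfl) hk).1 hq
  simpa using eval_injOn hw hw' (h.trans h'.symm)

lemma disjoint_psi_appendBlock {x : Letter} (hx : x = .p ∨ x = .q) {n k j : ℕ} (hk : 1 ≤ k)
    (hj : j ∈ Set.Icc k n) :
    Disjoint (psi x '' EvilGraded n k) (appendBlock (n + 1 - j) '' EvilGraded j (k - 1)) := by
  rw [Set.disjoint_left]
  intro π hp hb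
  obtain ⟨w, hw, -, -, h⟩ := (mem_image_psi_iff hx hk).1 hp
  obtain ⟨w', hw', -, -, h'⟩ := (mem_image_appendBlock_iff hk hj).1 hb
  have := eval_injOn hw hw' (h.trans h'.symm)
  cases hm : n - j with
  | zero => rw [hm] at this; rcases hx with rfl | rfl <;> simp at this
  | succ m => rw [hm] at this; rcases hx with rfl | rfl <;> simp [List.replicate_succ] at this

lemma pairwiseDisjoint_appendBlock (n : ℕ) {k : ℕ} (hk : 1 ≤ k) :
    (Set.Icc k n).PairwiseDisjoint fun j => appendBlock (n + 1 - j) '' EvilGraded j (k - 1) := by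
  intro i hi j hj hij
  rw [Function.onFun, Set.disjoint_left]
  intro π h1 h2
  obtain ⟨w, hw, -, -, h⟩ := (mem_image_appendBlock_iff hk hi).1 h1
  obtain ⟨w', hw', -, -, h'⟩ := (mem_image_appendBlock_iff hk hj).1 h2
  have := block_inj (eval_injOn hw hw' (h.trans h'.symm))
  have := hi.2
  have := hj.2
  exact hij (by omega)

end EvilPerm

theorem mainTheorem3 :
    -- the operators map their domains to evil-avoiding permutations
    (∀ x : EvilPerm.Letter,
      Set.MapsTo (EvilPerm.psi x) (EvilPerm.psiDomain x) EvilPerm.Evil) ∧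
    -- unique factorization
    (∀ π ∈ EvilPerm.Evil,
      ∃! w : List EvilPerm.Letter, EvilPerm.IsValid w ∧ EvilPerm.eval w = π) ∧
    -- the valid words of positive length encode the nonempty evil-avoiding permutations uniquely
    Set.BijOn EvilPerm.eval {w | w ∈ EvilPerm.LEvil} {π | π ∈ EvilPerm.Evil ∧ 1 ≤ π.1} ∧
    -- size and number of recoils are read off the word
    (∀ w : List EvilPerm.Letter, EvilPerm.IsValid w →
      (EvilPerm.eval w).1 = w.length ∧
      EvilPerm.numRecoils (EvilPerm.eval w) = w.count EvilPerm.Letter.r) ∧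
    -- the two descriptions of the language of valid words
    (∀ w : List EvilPerm.Letter, w ∈ EvilPerm.LEvil ↔
      w.getLast? = some EvilPerm.Letter.s ∧
      ¬ [EvilPerm.Letter.s, EvilPerm.Letter.p] <:+: w ∧
      ¬ [EvilPerm.Letter.s, EvilPerm.Letter.q] <:+: w ∧
      ∀ (u : List EvilPerm.Letter) (m : ℕ),
        w ≠ u ++ EvilPerm.Letter.p :: List.replicate m EvilPerm.Letter.s ∧
        w ≠ u ++ EvilPerm.Letter.q :: List.replicate m EvilPerm.Letter.s) ∧
    EvilPerm.LEvil = EvilPerm.evilRegex.matches' ∧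
    -- effect of the operators on the number of recoils
    (∀ π ∈ EvilPerm.psiDomain .p,
      EvilPerm.numRecoils (EvilPerm.psi .p π) = EvilPerm.numRecoils π) ∧
    (∀ π ∈ EvilPerm.psiDomain .q,
      EvilPerm.numRecoils (EvilPerm.psi .q π) = EvilPerm.numRecoils π) ∧
    (∀ π ∈ EvilPerm.psiDomain .s,
      EvilPerm.numRecoils (EvilPerm.psi .s π) = EvilPerm.numRecoils π) ∧
    (∀ π ∈ EvilPerm.psiDomain .r,
      EvilPerm.numRecoils (EvilPerm.psi .r π) = EvilPerm.numRecoils π + 1) ∧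
    -- the recursive decomposition by size and number of recoils
    (∀ n : ℕ, EvilPerm.EvilGraded n 0 = {EvilPerm.idPerm n}) ∧
    (∀ k : ℕ, 1 ≤ k → EvilPerm.EvilGraded 0 k = ∅) ∧
    (∀ n k : ℕ, 1 ≤ k →
      EvilPerm.EvilGraded (n + 1) k =
        EvilPerm.psi .p '' EvilPerm.EvilGraded n k ∪
        EvilPerm.psi .q '' EvilPerm.EvilGraded n k ∪
        ⋃ j ∈ Set.Icc k n,
          EvilPerm.appendBlock (n + 1 - j) '' EvilPerm.EvilGraded j (k - 1)) ∧
    (∀ n k : ℕ, 1 ≤ k →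
      Disjoint (EvilPerm.psi .p '' EvilPerm.EvilGraded n k)
        (EvilPerm.psi .q '' EvilPerm.EvilGraded n k) ∧
      (∀ j ∈ Set.Icc k n,
        Disjoint (EvilPerm.psi .p '' EvilPerm.EvilGraded n k)
          (EvilPerm.appendBlock (n + 1 - j) '' EvilPerm.EvilGraded j (k - 1)) ∧
        Disjoint (EvilPerm.psi .q '' EvilPerm.EvilGraded n k)
          (EvilPerm.appendBlock (n + 1 - j) '' EvilPerm.EvilGraded j (k - 1))) ∧
      (Set.Icc k n).PairwiseDisjoint fun j =>
        EvilPerm.appendBlock (n + 1 - j) '' EvilPerm.EvilGraded j (k - 1)) ∧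
    -- the block operators are compositions of the operators `r` and `s`
    (∀ π ∈ EvilPerm.psiDomain .r, ∀ m : ℕ,
      (EvilPerm.psi .s)^[m] (EvilPerm.psi .r π) ∈ EvilPerm.psiDomain .s ∧
      (EvilPerm.psi .s)^[m] (EvilPerm.psi .r π) = EvilPerm.appendBlock (m + 1) π) := by
  open EvilPerm in
  refine ⟨mapsTo_psi, ?_, ?_, ?_, ?_, ?_, fun π _ => numRecoils_psiP π, fun π => numRecoils_psiQ,
    fun π => numRecoils_psiS, fun π => numRecoils_psiR, evilGraded_zero_right,
    fun k => evilGraded_zero_left, fun n k => evilGraded_succ n, ?_, fun π => iterate_psi_s⟩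
  · intro π hπ
    obtain ⟨w, hw, h⟩ := exists_word hπ
    exact ⟨w, ⟨hw, h⟩, fun w' hw' => eval_injOn hw'.1 hw (hw'.2.trans h.symm)⟩
  · refine ⟨?_, fun w hw w' hw' h => eval_injOn hw.2 hw'.2 h, ?_⟩
    · rintro w ⟨h0, hw⟩
      exact ⟨eval_mem_evil hw, by rw [fst_eval]; exact List.length_pos_iff.2 h0⟩
    · rintro π ⟨hπ, h1⟩
      obtain ⟨w, hw, rfl⟩ := exists_word hπ
      rw [fst_eval] at h1
      exact ⟨w, ⟨List.length_pos_iff.1 h1, hw⟩, rfl⟩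
  · exact fun w hw => ⟨fst_eval w, numRecoils_eval hw⟩
  · intro w
    constructor
    · exact fun ⟨h0, hw⟩ => (isValid_iff h0).1 hw
    · intro h
      have h0 : w ≠ [] := by rintro rfl; simp at h
      exact ⟨h0, (isValid_iff h0).2 h⟩
  · exact le_antisymm le_evilRegex evilRegex_le
  · exact fun n k hk => ⟨disjoint_psi_p_psi_q n hk,
      fun j hj => ⟨disjoint_psi_appendBlock (Or.inl rfl) hk hj,
        disjoint_psi_appendBlock (Or.inr rfl) hk hj⟩, pairwiseDisjoint_appendBlock n hk⟩
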